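/- **Setting.** $D^{2,2,2}$ is the modular lattice with unity $I$ generated by $x_1,x_2,x_3,y_1,y_2,y_3$ subject to $x_i\subseteq y_i$ $(i=1,2,3)$; $a+b$ denotes the sum (join) and $ab$ the intersection (meet). A representation $\rho$ of $D^{2,2,2}$ in a finite-dimensional vector space $X_0$ over a field is a lattice morphism from $D^{2,2,2}$ to the lattice of subspaces of $X_0$ with $\rho(I)=X_0$. Put $$X_0^1=\{(\eta_1,\eta_2,\eta_3)\mid \eta_j\in\rho(y_j),\ \eta_1+\eta_2+\eta_3=0\},\qquad \varphi_i:X_0^1\to X_0,\ (\eta_1,\eta_2,\eta_3)\mapsto\eta_i,$$ and let $\Phi^+\rho$ be the representation in $X_0^1$ with $\Phi^+\rho(x_i)=\{\eta\in X^1_0\mid\eta_i=0\}$ and $\Phi^+\rho(y_i)=\{\eta\in X^1_0\mid\eta_i\in\rho(x_i)\}$. For $\{i,j,k\}=\{1,2,3\}$ let $a^{ij}_0=A^{ij}_0=I$ and, for $n\ge1$, $a^{ij}_n=x_i+y_ja^{jk}_{n-1}$, $A^{ij}_n=y_i+x_jA^{ki}_{n-1}$. A non-empty sequence $\alpha=i_n\dots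 i_1$ with entries in $\{1,2,3\}$ is admissible if adjacent entries are distinct; sequences obtained from each other by replacing pieces $iji$ by $iki$ ($i,j,k$ distinct) are identified. For the following sequences $\alpha$ starting at $i_1=1$ the admissible elements $f_\alpha,e_\alpha,g_{\alpha0}\in D^{2,2,2}$ are defined by the table, where $q=k+3p$, $\gamma=(213)^{2p}(21)^{2k}$ with $k>0$, $p\ge0$ (lines 1–6), $k\ge0$ (lines 7–8), $\beta=(213)^{2p}(21)^{2k+1}$ with $k\ge0$, $p\ge0$ (lines 9–14): $$\begin{array}{l|l|l|l|l} & \alpha & f_\alpha & e_\alpha & g_{\alpha0}\\ \hline 1&\gamma & y_1y_2a^{13}_qA^{32}_{k-1} & y_2A^{32}_{k-1}a^{21}_qA^{13}_ka^{13}_q & e_\alpha(x_1+a^{32}_qA^{32}_k)\\ 2&3\gamma & y_3(x_1+x_2)A^{23}_qa^{31}_{k-1} & y_3a^{31}_{k-1}A^{12}_{q+1}a^{12}_kA^{23}_q & e_\alpha(y_2y_3+A^{12}_qa^{31}_k)\\ 3&13\gamma & y_3y_1a^{32}_{q+1}A^{21}_{k-1} & y_1A^{21}_{k-1}a^{13}_{q+1}A^{32}_ka^{32}_{q+1}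 & e_\alpha(x_3+a^{21}_{q+1}A^{21}_k)\\ 4&(213)\gamma & y_2(x_3+x_1)A^{12}_{q+1}a^{23}_{k-1} & y_2a^{23}_{k-1}A^{31}_{q+2}a^{31}_kA^{12}_{q+1} & e_\alpha(y_1y_2+A^{31}_{q+1}a^{23}_k)\\ 5&3(213)\gamma & y_2y_3a^{21}_{q+2}A^{13}_{k-1} & y_3A^{13}_{k-1}a^{32}_{q+2}A^{21}_ka^{21}_{q+2} & e_\alpha(x_2+a^{13}_{q+2}A^{13}_k)\\ 6&13(213)\gamma & y_1(x_2+x_3)A^{31}_{q+2}a^{12}_{k-1} & y_1a^{12}_{k-1}A^{23}_{q+3}a^{23}_kA^{31}_{q+2} & e_\alpha(y_1y_3+A^{23}_{q+2}a^{12}_k)\\ 7&1(21)^{2k} & x_1A^{23}_ka^{23}_k & y_1A^{31}_ka^{12}_kA^{23}_ka^{23}_k & e_\alpha(y_2a^{21}_k+y_3a^{31}_k)\\ 8&1(21)^{2k+1} & y_1(x_2+x_3)A^{31}_ka^{12}_k & y_1A^{31}_ka^{12}_kA^{23}_{k+1}a^{23}_{k+1} & e_\alpha(y_1a^{12}_{k+1}+y_1a^{13}_{k+1})\\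 9&\beta & y_2y_3a^{21}_qA^{13}_k & y_2A^{32}_ka^{21}_qA^{13}_ka^{13}_{q+1} & e_\alpha(x_2+a^{13}_qA^{13}_{k+1})\\ 10&3\beta & x_3A^{12}_{q+1}a^{12}_k & y_3a^{31}_kA^{12}_{q+1}a^{12}_kA^{23}_{q+1} & e_\alpha(y_1y_3+A^{23}_qa^{12}_{k+1})\\ 11&13\beta & y_1y_2a^{13}_{q+1}A^{32}_k & y_1A^{21}_ka^{13}_{q+1}A^{32}_ka^{32}_{q+2} & e_\alpha(x_1+a^{32}_{q+1}A^{32}_{k+1})\\ 12&(213)\beta & x_2A^{31}_{q+2}a^{31}_k & y_2a^{23}_kA^{31}_{q+2}a^{31}_kA^{12}_{q+2} & e_\alpha(y_2y_3+A^{12}_{q+1}a^{31}_{k+1})\\ 13&3(213)\beta & y_3y_1a^{32}_{q+2}A^{21}_k & y_3A^{13}_ka^{32}_{q+2}A^{21}_ka^{21}_{q+3} & e_\alpha(x_3+a^{21}_{q+2}A^{21}_{k+1})\\ 14&13(213)\beta & x_1A^{23}_{q+3}a^{23}_k & y_1a^{12}_kA^{23}_{q+3}a^{23}_kA^{31}_{q+3}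 & e_\alpha(y_1y_2+A^{31}_{q+2}a^{23}_{k+1}) \end{array}$$ For the other admissible sequences the elements are obtained by permuting the indices: if $\alpha=\sigma(\alpha')$ with $\alpha'$ in the table and $\sigma$ a permutation of $\{1,2,3\}$, apply $\sigma$ to all indices in $f_{\alpha'},e_{\alpha'},g_{\alpha'0}$. **Theorem (on classes of admissible elements).** Let $\alpha=i_ni_{n-1}\dots i_1$ be an admissible sequence for $D^{2,2,2}$ and $i\ne i_n$. Then $i\alpha$ is admissible, elements $f,e,g$ are defined in this way for both $\alpha$ and $i\alpha$, and for each of $z_\alpha=f_\alpha,e_\alpha,g_{\alpha0}$ $$\varphi_i\,\Phi^+\rho(z_\alpha)=\rho(z_{i\alpha})$$ for every representation $\rho$ (whenever the construction allows several choices of the table line and of $\sigma$ for $\alpha$ or for $i\alpha$, the equality holds for all choices). -/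

import Mathlib

/-! The indices `1, 2, 3` are the elements `1, 2, 3 = 0` of `Fin 3`.  In all lattices `a ⊔ b` is
the sum `a + b` and `a ⊓ b` is the intersection `ab`; the unity `I` is `⊤`. -/

namespace D222

/-! ### The modular lattice `D^{2,2,2}` -/

/-- Lattice polynomials in `x_1, x_2, x_3, y_1, y_2, y_3` and the unity `I`. -/
inductive Poly : Type
  | x (i : Fin 3) : Poly
  | y (i : Fin 3) : Poly
  | one : Poly
  | sum (a b : Poly) : Poly
  | inter (a b : Poly) : Poly

/-- The smallest preorder on lattice polynomials for which the quotient is a modular lattice with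
greatest element `I` in which `x_i ⊆ y_i`. -/
inductive Poly.Le : Poly → Poly → Prop
  | refl (a : Poly) : Poly.Le a a
  | trans {a b c : Poly} : Poly.Le a b → Poly.Le b c → Poly.Le a c
  | left_le_sum (a b : Poly) : Poly.Le a (.sum a b)
  | right_le_sum (a b : Poly) : Poly.Le b (.sum a b)
  | sum_le {a b c : Poly} : Poly.Le a c → Poly.Le b c → Poly.Le (.sum a b) c
  | inter_le_left (a b : Poly) : Poly.Le (.inter a b) a
  | inter_le_right (a b : Poly) : Poly.Le (.inter a b) b
  | le_inter {a b c : Poly} : Poly.Le a b → Poly.Le a c → Poly.Le a (.inter b c)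
  | le_one (a : Poly) : Poly.Le a .one
  | modular {a c : Poly} (b : Poly) : Poly.Le a c →
      Poly.Le (.inter (.sum a b) c) (.sum a (.inter b c))
  | x_le_y (i : Fin 3) : Poly.Le (.x i) (.y i)

instance : Preorder Poly where
  le := Poly.Le
  le_refl := Poly.Le.refl
  le_trans _ _ _ := Poly.Le.trans

/-- The modular lattice `D^{2,2,2}` (with unity `I`) generated by `x_i ⊆ y_i`, `i = 1, 2, 3`. -/
def D : Type := Antisymmetrization Poly (· ≤ ·)

instance : PartialOrder D :=
  inferInstanceAs (PartialOrder (Antisymmetrization Poly (· ≤ ·)))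

/-- The class of a lattice polynomial. -/
def mk (a : Poly) : D := toAntisymmetrization (· ≤ ·) a

theorem mk_le_mk {a b : Poly} : mk a ≤ mk b ↔ Poly.Le a b := Iff.rfl

theorem mk_eq_mk {a b : Poly} : mk a = mk b ↔ Poly.Le a b ∧ Poly.Le b a := by
  rw [le_antisymm_iff, mk_le_mk, mk_le_mk]

theorem ind {P : D → Prop} (h : ∀ a, P (mk a)) (a : D) : P a :=
  Quotient.inductionOn a h

instance : Lattice D :=
  { (inferInstance : PartialOrder D) with
    sup := Quotient.map₂ Poly.sum fun _ _ h₁ _ _ h₂ =>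
      ⟨.sum_le (.trans h₁.1 (.left_le_sum _ _)) (.trans h₂.1 (.right_le_sum _ _)),
        .sum_le (.trans h₁.2 (.left_le_sum _ _)) (.trans h₂.2 (.right_le_sum _ _))⟩
    inf := Quotient.map₂ Poly.inter fun _ _ h₁ _ _ h₂ =>
      ⟨.le_inter (.trans (.inter_le_left _ _) h₁.1) (.trans (.inter_le_right _ _) h₂.1),
        .le_inter (.trans (.inter_le_left _ _) h₁.2) (.trans (.inter_le_right _ _) h₂.2)⟩
    le_sup_left := ind fun a => ind fun b => Poly.Le.left_le_sum a b
    le_sup_right := ind fun a => ind fun b => Poly.Le.right_le_sum a b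
    sup_le := ind fun _ => ind fun _ => ind fun _ => Poly.Le.sum_le
    inf_le_left := ind fun a => ind fun b => Poly.Le.inter_le_left a b
    inf_le_right := ind fun a => ind fun b => Poly.Le.inter_le_right a b
    le_inf := ind fun _ => ind fun _ => ind fun _ => Poly.Le.le_inter }

instance : OrderTop D where
  top := mk .one
  le_top := ind Poly.Le.le_one

theorem mk_sum (a b : Poly) : mk (.sum a b) = mk a ⊔ mk b := rfl

theorem mk_inter (a b : Poly) : mk (.inter a b) = mk a ⊓ mk b := rfl

theorem mk_one : mk .one = ⊤ := rfl

instance : IsModularLattice D where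
  sup_inf_le_assoc_of_le {a} b {c} := by
    induction a using ind
    induction b using ind
    induction c using ind
    exact Poly.Le.modular _

/-- The generator `x_i`. -/
def x (i : Fin 3) : D := mk (.x i)

/-- The generator `y_i`. -/
def y (i : Fin 3) : D := mk (.y i)

theorem x_le_y (i : Fin 3) : x i ≤ y i := Poly.Le.x_le_y i

section Lift

/-- The value of a lattice polynomial. -/
def Poly.eval {L : Type*} [Lattice L] [OrderTop L] (X Y : Fin 3 → L) : Poly → L
  | .x i => X i
  | .y i => Y i
  | .one => ⊤
  | .sum a b => a.eval X Y ⊔ b.eval X Y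
  | .inter a b => a.eval X Y ⊓ b.eval X Y

theorem Poly.eval_mono {L : Type*} [Lattice L] [OrderTop L] [IsModularLattice L] {X Y : Fin 3 → L}
    (h : ∀ i, X i ≤ Y i) {a b : Poly} (hab : Poly.Le a b) : a.eval X Y ≤ b.eval X Y := by
  induction hab with
  | refl a => exact le_rfl
  | trans _ _ h₁ h₂ => exact h₁.trans h₂
  | left_le_sum a b => exact le_sup_left
  | right_le_sum a b => exact le_sup_right
  | sum_le _ _ h₁ h₂ => exact sup_le h₁ h₂
  | inter_le_left a b => exact inf_le_left
  | inter_le_right a b => exact inf_le_right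
  | le_inter _ _ h₁ h₂ => exact le_inf h₁ h₂
  | le_one a => exact le_top
  | modular b _ h₁ => exact IsModularLattice.sup_inf_le_assoc_of_le _ h₁
  | x_le_y i => exact h i

/-- The universal property of `D^{2,2,2}`: the lattice morphism to a modular lattice with unity
that sends `x_i` to `X i` and `y_i` to `Y i` (and `I` to the unity, see `lift_top`). -/
def lift {L : Type*} [Lattice L] [OrderTop L] [IsModularLattice L] (X Y : Fin 3 → L)
    (h : ∀ i, X i ≤ Y i) : LatticeHom D L where
  toFun := Quotient.lift (Poly.eval X Y) fun _ _ hab =>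
    le_antisymm (Poly.eval_mono h hab.1) (Poly.eval_mono h hab.2)
  map_sup' := ind fun _ => ind fun _ => rfl
  map_inf' := ind fun _ => ind fun _ => rfl

variable {L : Type*} [Lattice L] [OrderTop L] [IsModularLattice L] (X Y : Fin 3 → L)
    (h : ∀ i, X i ≤ Y i)

theorem lift_top : lift X Y h ⊤ = ⊤ := rfl

theorem lift_x (i : Fin 3) : lift X Y h (x i) = X i := rfl

theorem lift_y (i : Fin 3) : lift X Y h (y i) = Y i := rfl

end Lift

/-- The endomorphism of `D^{2,2,2}` that renames the indices by the permutation `σ`. -/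
def relabel (σ : Equiv.Perm (Fin 3)) : LatticeHom D D :=
  lift (fun i => x (σ i)) (fun i => y (σ i)) fun i => x_le_y (σ i)

/-! ### Atomic elements -/

/-- For `i ≠ j`, the index `k` with `{i, j, k} = {1, 2, 3}` (as `1 + 2 + 3 = 0` in `Fin 3`). -/
def third (i j : Fin 3) : Fin 3 := -(i + j)

theorem third_spec : ∀ i j : Fin 3, i ≠ j → third i j ≠ i ∧ third i j ≠ j := by decide

/-- The atomic element `a_n^{ij}` (used for `i ≠ j`). -/
def a (i j : Fin 3) : ℕ → D
  | 0 => ⊤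
  | n + 1 => x i ⊔ (y j ⊓ a j (third i j) n)

/-- The atomic element `A_n^{ij}` (used for `i ≠ j`). -/
def A (i j : Fin 3) : ℕ → D
  | 0 => ⊤
  | n + 1 => y i ⊔ (x j ⊓ A (third i j) i n)

/-! ### Admissible sequences

The sequence `i_n … i_1` is the list `[i_n, …, i_1]`. -/

/-- A (non-empty) sequence of indices is admissible if its adjacent indices are distinct. -/
def Admissible (α : List (Fin 3)) : Prop := α ≠ [] ∧ α.IsChain (· ≠ ·)

/-- Replacing a piece `iji` of a sequence by `iki`, where `i, j, k` are distinct. -/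
inductive Step : List (Fin 3) → List (Fin 3) → Prop
  | mk (u v : List (Fin 3)) (i j k : Fin 3) (hij : i ≠ j) (hik : i ≠ k) (hjk : j ≠ k) :
      Step (u ++ [i, j, i] ++ v) (u ++ [i, k, i] ++ v)

/-- Identification of sequences: finitely many replacements `…iji… = …iki…`. -/
def SameSeq : List (Fin 3) → List (Fin 3) → Prop := Relation.EqvGen Step

/-- The power `w^n` of a word. -/
def wpow (w : List (Fin 3)) (n : ℕ) : List (Fin 3) := (List.replicate n w).flatten

/-! ### The table of admissible elements -/

/-- `Table α f e g` lists the 14 classes of admissible sequences `α` (starting at `i_1 = 1`)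
together with `f = f_α`, `e = e_α`, `g = g_{α0}`. -/
inductive Table : List (Fin 3) → D → D → D → Prop
  | line1 (k p q : ℕ) (γ : List (Fin 3)) (e : D) (hk : 0 < k) (hq : q = k + 3 * p)
      (hγ : γ = wpow [2, 1, 3] (2 * p) ++ wpow [2, 1] (2 * k))
      (he : e = y 2 ⊓ A 3 2 (k - 1) ⊓ a 2 1 q ⊓ A 1 3 k ⊓ a 1 3 q) :
      Table γ (y 1 ⊓ y 2 ⊓ a 1 3 q ⊓ A 3 2 (k - 1)) e
        (e ⊓ (x 1 ⊔ (a 3 2 q ⊓ A 3 2 k)))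
  | line2 (k p q : ℕ) (γ : List (Fin 3)) (e : D) (hk : 0 < k) (hq : q = k + 3 * p)
      (hγ : γ = wpow [2, 1, 3] (2 * p) ++ wpow [2, 1] (2 * k))
      (he : e = y 3 ⊓ a 3 1 (k - 1) ⊓ A 1 2 (q + 1) ⊓ a 1 2 k ⊓ A 2 3 q) :
      Table ([3] ++ γ) (y 3 ⊓ (x 1 ⊔ x 2) ⊓ A 2 3 q ⊓ a 3 1 (k - 1)) e
        (e ⊓ ((y 2 ⊓ y 3) ⊔ (A 1 2 q ⊓ a 3 1 k)))
  | line3 (k p q : ℕ) (γ : List (Fin 3)) (e : D) (hk : 0 < k) (hq : q = k + 3 * p)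
      (hγ : γ = wpow [2, 1, 3] (2 * p) ++ wpow [2, 1] (2 * k))
      (he : e = y 1 ⊓ A 2 1 (k - 1) ⊓ a 1 3 (q + 1) ⊓ A 3 2 k ⊓ a 3 2 (q + 1)) :
      Table ([1, 3] ++ γ) (y 3 ⊓ y 1 ⊓ a 3 2 (q + 1) ⊓ A 2 1 (k - 1)) e
        (e ⊓ (x 3 ⊔ (a 2 1 (q + 1) ⊓ A 2 1 k)))
  | line4 (k p q : ℕ) (γ : List (Fin 3)) (e : D) (hk : 0 < k) (hq : q = k + 3 * p)
      (hγ : γ = wpow [2, 1, 3] (2 * p) ++ wpow [2, 1] (2 * k))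
      (he : e = y 2 ⊓ a 2 3 (k - 1) ⊓ A 3 1 (q + 2) ⊓ a 3 1 k ⊓ A 1 2 (q + 1)) :
      Table ([2, 1, 3] ++ γ) (y 2 ⊓ (x 3 ⊔ x 1) ⊓ A 1 2 (q + 1) ⊓ a 2 3 (k - 1)) e
        (e ⊓ ((y 1 ⊓ y 2) ⊔ (A 3 1 (q + 1) ⊓ a 2 3 k)))
  | line5 (k p q : ℕ) (γ : List (Fin 3)) (e : D) (hk : 0 < k) (hq : q = k + 3 * p)
      (hγ : γ = wpow [2, 1, 3] (2 * p) ++ wpow [2, 1] (2 * k))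
      (he : e = y 3 ⊓ A 1 3 (k - 1) ⊓ a 3 2 (q + 2) ⊓ A 2 1 k ⊓ a 2 1 (q + 2)) :
      Table ([3] ++ [2, 1, 3] ++ γ) (y 2 ⊓ y 3 ⊓ a 2 1 (q + 2) ⊓ A 1 3 (k - 1)) e
        (e ⊓ (x 2 ⊔ (a 1 3 (q + 2) ⊓ A 1 3 k)))
  | line6 (k p q : ℕ) (γ : List (Fin 3)) (e : D) (hk : 0 < k) (hq : q = k + 3 * p)
      (hγ : γ = wpow [2, 1, 3] (2 * p) ++ wpow [2, 1] (2 * k))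
      (he : e = y 1 ⊓ a 1 2 (k - 1) ⊓ A 2 3 (q + 3) ⊓ a 2 3 k ⊓ A 3 1 (q + 2)) :
      Table ([1, 3] ++ [2, 1, 3] ++ γ) (y 1 ⊓ (x 2 ⊔ x 3) ⊓ A 3 1 (q + 2) ⊓ a 1 2 (k - 1)) e
        (e ⊓ ((y 1 ⊓ y 3) ⊔ (A 2 3 (q + 2) ⊓ a 1 2 k)))
  | line7 (k : ℕ) (e : D)
      (he : e = y 1 ⊓ A 3 1 k ⊓ a 1 2 k ⊓ A 2 3 k ⊓ a 2 3 k) :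
      Table ([1] ++ wpow [2, 1] (2 * k)) (x 1 ⊓ A 2 3 k ⊓ a 2 3 k) e
        (e ⊓ ((y 2 ⊓ a 2 1 k) ⊔ (y 3 ⊓ a 3 1 k)))
  | line8 (k : ℕ) (e : D)
      (he : e = y 1 ⊓ A 3 1 k ⊓ a 1 2 k ⊓ A 2 3 (k + 1) ⊓ a 2 3 (k + 1)) :
      Table ([1] ++ wpow [2, 1] (2 * k + 1)) (y 1 ⊓ (x 2 ⊔ x 3) ⊓ A 3 1 k ⊓ a 1 2 k) e
        (e ⊓ ((y 1 ⊓ a 1 2 (k + 1)) ⊔ (y 1 ⊓ a 1 3 (k + 1))))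
  | line9 (k p q : ℕ) (β : List (Fin 3)) (e : D) (hq : q = k + 3 * p)
      (hβ : β = wpow [2, 1, 3] (2 * p) ++ wpow [2, 1] (2 * k + 1))
      (he : e = y 2 ⊓ A 3 2 k ⊓ a 2 1 q ⊓ A 1 3 k ⊓ a 1 3 (q + 1)) :
      Table β (y 2 ⊓ y 3 ⊓ a 2 1 q ⊓ A 1 3 k) e
        (e ⊓ (x 2 ⊔ (a 1 3 q ⊓ A 1 3 (k + 1))))
  | line10 (k p q : ℕ) (β : List (Fin 3)) (e : D) (hq : q = k + 3 * p)
      (hβ : β = wpow [2, 1, 3] (2 * p) ++ wpow [2, 1] (2 * k + 1))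
      (he : e = y 3 ⊓ a 3 1 k ⊓ A 1 2 (q + 1) ⊓ a 1 2 k ⊓ A 2 3 (q + 1)) :
      Table ([3] ++ β) (x 3 ⊓ A 1 2 (q + 1) ⊓ a 1 2 k) e
        (e ⊓ ((y 1 ⊓ y 3) ⊔ (A 2 3 q ⊓ a 1 2 (k + 1))))
  | line11 (k p q : ℕ) (β : List (Fin 3)) (e : D) (hq : q = k + 3 * p)
      (hβ : β = wpow [2, 1, 3] (2 * p) ++ wpow [2, 1] (2 * k + 1))
      (he : e = y 1 ⊓ A 2 1 k ⊓ a 1 3 (q + 1) ⊓ A 3 2 k ⊓ a 3 2 (q + 2)) :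
      Table ([1, 3] ++ β) (y 1 ⊓ y 2 ⊓ a 1 3 (q + 1) ⊓ A 3 2 k) e
        (e ⊓ (x 1 ⊔ (a 3 2 (q + 1) ⊓ A 3 2 (k + 1))))
  | line12 (k p q : ℕ) (β : List (Fin 3)) (e : D) (hq : q = k + 3 * p)
      (hβ : β = wpow [2, 1, 3] (2 * p) ++ wpow [2, 1] (2 * k + 1))
      (he : e = y 2 ⊓ a 2 3 k ⊓ A 3 1 (q + 2) ⊓ a 3 1 k ⊓ A 1 2 (q + 2)) :
      Table ([2, 1, 3] ++ β) (x 2 ⊓ A 3 1 (q + 2) ⊓ a 3 1 k) e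
        (e ⊓ ((y 2 ⊓ y 3) ⊔ (A 1 2 (q + 1) ⊓ a 3 1 (k + 1))))
  | line13 (k p q : ℕ) (β : List (Fin 3)) (e : D) (hq : q = k + 3 * p)
      (hβ : β = wpow [2, 1, 3] (2 * p) ++ wpow [2, 1] (2 * k + 1))
      (he : e = y 3 ⊓ A 1 3 k ⊓ a 3 2 (q + 2) ⊓ A 2 1 k ⊓ a 2 1 (q + 3)) :
      Table ([3] ++ [2, 1, 3] ++ β) (y 3 ⊓ y 1 ⊓ a 3 2 (q + 2) ⊓ A 2 1 k) e
        (e ⊓ (x 3 ⊔ (a 2 1 (q + 2) ⊓ A 2 1 (k + 1))))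
  | line14 (k p q : ℕ) (β : List (Fin 3)) (e : D) (hq : q = k + 3 * p)
      (hβ : β = wpow [2, 1, 3] (2 * p) ++ wpow [2, 1] (2 * k + 1))
      (he : e = y 1 ⊓ a 1 2 k ⊓ A 2 3 (q + 3) ⊓ a 2 3 k ⊓ A 3 1 (q + 3)) :
      Table ([1, 3] ++ [2, 1, 3] ++ β) (x 1 ⊓ A 2 3 (q + 3) ⊓ a 2 3 k) e
        (e ⊓ ((y 1 ⊓ y 2) ⊔ (A 3 1 (q + 2) ⊓ a 2 3 (k + 1))))

/-- `f`, `e`, `g` are the admissible elements `f_α`, `e_α`, `g_{α0}`: up to a permutation `σ` of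
the indices `1, 2, 3`, they stand in a line of the table whose sequence is `α` up to replacements
`…iji… = …iki…`. -/
def AdmissibleElements (α : List (Fin 3)) (f e g : D) : Prop :=
  ∃ (σ : Equiv.Perm (Fin 3)) (w : List (Fin 3)) (f₀ e₀ g₀ : D),
    Table w f₀ e₀ g₀ ∧ SameSeq α (w.map σ) ∧
      f = relabel σ f₀ ∧ e = relabel σ e₀ ∧ g = relabel σ g₀

/-! ### Representations, the functor `Φ⁺`, the elementary maps -/

/-- A linear representation of `D^{2,2,2}` in `X`: a lattice morphism to the lattice of linear
subspaces of `X`, sending the unity `I` to `X`. -/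
structure Rep (K X : Type*) [Field K] [AddCommGroup X] [Module K X] extends
    LatticeHom D (Submodule K X) where
  map_unity : toFun ⊤ = ⊤

namespace Rep

variable {K X : Type*} [Field K] [AddCommGroup X] [Module K X]

instance : CoeFun (Rep K X) fun _ => D → Submodule K X := ⟨fun ρ => ρ.toLatticeHom⟩

/-- `R = Y_1 ⊕ Y_2 ⊕ Y_3`, where `Y_i = ρ(y_i)`. -/
abbrev R (ρ : Rep K X) : Type _ := (i : Fin 3) → ρ (y i)

/-- `∇ : R → X_0`, `(η_1, η_2, η_3) ↦ η_1 + η_2 + η_3`. -/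
def nabla (ρ : Rep K X) : ρ.R →ₗ[K] X :=
  ∑ i : Fin 3, (ρ (y i)).subtype ∘ₗ LinearMap.proj i

/-- `X_0^1 = {(η_1, η_2, η_3) ∈ R | η_1 + η_2 + η_3 = 0}`. -/
def X01 (ρ : Rep K X) : Submodule K ρ.R := LinearMap.ker ρ.nabla

/-- The elementary map `φ_i : X_0^1 → X_0`, `(η_1, η_2, η_3) ↦ η_i`. -/
def φ (ρ : Rep K X) (i : Fin 3) : ρ.X01 →ₗ[K] X :=
  (ρ (y i)).subtype ∘ₗ LinearMap.proj i ∘ₗ ρ.X01.subtype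

/-- The representation `Φ⁺ρ` in `X_0^1`: it sends `x_i` to `X_i^1 = {η ∈ X_0^1 | η_i = 0}` and
`y_i` to `Y_i^1 = {η ∈ X_0^1 | η_i ∈ ρ(x_i)}`. -/
def coxeter (ρ : Rep K X) : Rep K ρ.X01 where
  toLatticeHom := lift (fun i => LinearMap.ker (ρ.φ i)) (fun i => (ρ (x i)).comap (ρ.φ i))
    fun _ => Submodule.comap_mono bot_le
  map_unity := rfl

theorem mem_X01 (ρ : Rep K X) (η : ρ.R) :
    η ∈ ρ.X01 ↔ (η 1 : X) + (η 2 : X) + (η 3 : X) = 0 := by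
  have h : ρ.nabla η = (η 1 : X) + (η 2 : X) + (η 3 : X) := by
    simp only [nabla, Fin.sum_univ_three]
    exact (add_assoc _ _ _).trans (add_comm _ _)
  rw [X01, LinearMap.mem_ker, h]

theorem mem_coxeter_x (ρ : Rep K X) (i : Fin 3) (η : ρ.X01) :
    η ∈ ρ.coxeter (x i) ↔ (η.1 i : X) = 0 := Iff.rfl

theorem mem_coxeter_y (ρ : Rep K X) (i : Fin 3) (η : ρ.X01) :
    η ∈ ρ.coxeter (y i) ↔ (η.1 i : X) ∈ ρ (x i) := Iff.rfl

end Rep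

end D222

/-!
A sequence `α = i_n … i_1` is determined, up to the identification `…iji… = …iki…`, by its start and
by the numbers of its steps `i_{m+1} - i_m` equal to `+1` and to `-1` in `ℤ/3`: a replacement
exchanges two adjacent steps of opposite directions (`Walk.step`), and these exchanges generate
all rearrangements (`Walk.sameSeq`). In terms of the last index `h`, the neighbours `n` and `p` of
`h` in the more and in the less frequent direction, and the numbers `N ≥ M` of major and minor
steps, the fourteen lines of the table become four families, one for each pair of parities of
`N` and `M` (`elements`, `Table.exists_walk`).

The images under the elementary maps are computed from the formula
`φ_i (φ_i⁻¹ W ∩ φ_j⁻¹ U ∩ φ_k⁻¹ V) = W Y_i (U Y_j + V Y_k)` for subspaces (`Rep.map_inf_comap`),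
a consequence of `φ_i + φ_j + φ_k = 0`. The functor exchanges the two kinds of atomic elements:
`Φ⁺ρ(a_n^{ij}) = φ_i⁻¹ ρ(A_n^{kj})` and `Φ⁺ρ(A_n^{ij}) = φ_i⁻¹ ρ(a_n^{ik})` (`Rep.pulls_a`,
`Rep.pulls_A`). All the elements `f`, `e`, `g` can be written as intersections of such preimages, so
their images are given by lattice polynomials, which the modular law identifies with the elements
for one more major or one more minor step (`Rep.carries_major`, `Rep.carries_minor`).

For `N = M` either direction may be taken as the major one, and the two choices have to give the
same subspaces. This follows by induction on `N` from `φ_h φ_i = -φ_h φ_j` on the part of the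
twofold functor below `y_h` (`Rep.map_image_eq`, `Rep.agree_elements_diag`).
-/

universe u

namespace D222

/-! ### Index triples and the recursion of the atomic elements -/

/-- `i`, `j`, `k` are the three indices `1, 2, 3` in some order. -/
structure Triple (i j k : Fin 3) : Prop where
  ne₁₂ : i ≠ j
  ne₂₃ : j ≠ k
  ne₁₃ : i ≠ k

namespace Triple

variable {i j k : Fin 3}

theorem rot (H : Triple i j k) : Triple j k i := ⟨H.ne₂₃, H.ne₁₃.symm, H.ne₁₂.symm⟩

theorem swap (H : Triple i j k) : Triple k j i := ⟨H.ne₂₃.symm, H.ne₁₂.symm, H.ne₁₃.symm⟩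

theorem third_eq (H : Triple i j k) : third i j = k := by
  obtain ⟨h₁, h₂, h₃⟩ := H
  revert i j k
  decide

theorem eq_or (H : Triple i j k) (t : Fin 3) : t = i ∨ t = j ∨ t = k := by
  obtain ⟨h₁, h₂, h₃⟩ := H
  revert i j k t
  decide

theorem sum_eq (H : Triple i j k) {M : Type*} [AddCommMonoid M] (v : Fin 3 → M) :
    ∑ t, v t = v i + v j + v k := by
  have hu : (Finset.univ : Finset (Fin 3)) = {i, j, k} := by
    ext t
    simpa using H.eq_or t
  rw [hu, Finset.sum_insert (by simp [H.ne₁₂, H.ne₁₃]), Finset.sum_pair H.ne₂₃, add_assoc]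

theorem a_succ (H : Triple i j k) (n : ℕ) : a i j (n + 1) = x i ⊔ y j ⊓ a j k n := by
  rw [a, H.third_eq]

theorem A_succ (H : Triple i j k) (n : ℕ) : A i j (n + 1) = y i ⊔ x j ⊓ A k i n := by
  rw [A, H.third_eq]

end Triple

theorem a_zero (i j : Fin 3) : a i j 0 = ⊤ := rfl

theorem A_zero (i j : Fin 3) : A i j 0 = ⊤ := rfl

theorem x_le_a (i j : Fin 3) : ∀ n, x i ≤ a i j n
  | 0 => le_top
  | _ + 1 => le_sup_left

theorem y_le_A (i j : Fin 3) : ∀ n, y i ≤ A i j n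
  | 0 => le_top
  | _ + 1 => le_sup_left

theorem x_le_a_right (i j : Fin 3) : ∀ n, x j ≤ a i j n
  | 0 => le_top
  | _ + 1 => le_sup_of_le_right (le_inf (x_le_y j) (x_le_a _ _ _))

theorem x_le_A (i j : Fin 3) (n : ℕ) : x i ≤ A i j n := (x_le_y i).trans (y_le_A i j n)

theorem A_succ_le (n : ℕ) : ∀ i j, A i j (n + 1) ≤ A i j n := by
  induction n with
  | zero => exact fun _ _ => le_top
  | succ n ih => exact fun i j => sup_le_sup_left (inf_le_inf_left _ (ih _ _)) _

/-! ### Modular identities -/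

section Modular

variable {L : Type*} [Lattice L] [IsModularLattice L] {b c u v : L}

/-- The modular law, with the summand below `c` on the right. -/
theorem sup_inf_of_le_right (h : b ≤ c) : (u ⊔ b) ⊓ c = u ⊓ c ⊔ b := by
  rw [sup_comm, sup_inf_assoc_of_le _ h, sup_comm]

/-- The modular law, with the summand below `c` on the left. -/
theorem sup_inf_of_le_left (h : b ≤ c) : (b ⊔ u) ⊓ c = b ⊔ u ⊓ c :=
  sup_inf_assoc_of_le _ h

theorem inf_sup_of_le_right (h : b ≤ c) : c ⊓ (u ⊔ b) = c ⊓ u ⊔ b := by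
  rw [inf_comm, sup_inf_of_le_right h, inf_comm]

theorem inf_sup_of_le_left (h : b ≤ c) : c ⊓ (b ⊔ u) = b ⊔ c ⊓ u := by
  rw [inf_comm, sup_inf_of_le_left h, inf_comm]

end Modular

section Atomic

variable {i j k : Fin 3}

/-- Below `y_i y_j` the atomic elements `A_n^{kj}` and `a_n^{jk}` coincide. This reconciles the
lines of the table for equally many steps in both directions with the remaining ones. -/
theorem inf_A_eq_inf_a (n : ℕ) : ∀ {i j k : Fin 3}, Triple i j k →
    y i ⊓ y j ⊓ A k j n = y i ⊓ y j ⊓ a j k n := by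
  induction n with
  | zero => exact fun _ => rfl
  | succ n ih =>
    intro i j k H
    have hA : y j ⊓ A k j (n + 1) ⊓ A i k n = y j ⊓ y k ⊓ A i k n ⊔ x j ⊓ A i k n := by
      rw [H.swap.A_succ, inf_sup_of_le_right (inf_le_left.trans (x_le_y j)),
        sup_inf_of_le_right inf_le_right]
    have ha : y j ⊓ a j k (n + 1) ⊓ A i k n = y j ⊓ y k ⊓ A i k n ⊔ x j ⊓ A i k n := by
      have hle : y j ⊓ y k ⊓ a k i n ≤ A i k n := by
        rw [← ih H.rot]
        exact inf_le_right
      rw [H.rot.a_succ, inf_sup_of_le_left (x_le_y j), ← inf_assoc, sup_inf_of_le_right hle,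
        ← ih H.rot, sup_comm]
    have hy : y i = y i ⊓ A i k n := (inf_eq_left.2 (y_le_A i k n)).symm
    calc y i ⊓ y j ⊓ A k j (n + 1) = y i ⊓ (y j ⊓ A k j (n + 1) ⊓ A i k n) := by
          conv_lhs => rw [hy]
          ac_rfl
      _ = y i ⊓ (y j ⊓ a j k (n + 1) ⊓ A i k n) := by rw [hA, ha]
      _ = y i ⊓ y j ⊓ a j k (n + 1) := by
          conv_rhs => rw [hy]
          ac_rfl

end Atomic

/-! ### The elementary maps and the functor `Φ⁺` -/

namespace Rep

variable {K X : Type*} [Field K] [AddCommGroup X] [Module K X] (ρ : Rep K X) {i j k : Fin 3}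

theorem φ_mem (i : Fin 3) (η : ρ.X01) : ρ.φ i η ∈ ρ (y i) := (η.1 i).2

theorem mem_X01_iff (H : Triple i j k) (η : ρ.R) :
    η ∈ ρ.X01 ↔ (η i : X) + (η j : X) + (η k : X) = 0 := by
  rw [X01, LinearMap.mem_ker, ← H.sum_eq fun t => (η t : X)]
  simp [nabla]

theorem φ_add (H : Triple i j k) (η : ρ.X01) : ρ.φ i η + ρ.φ j η + ρ.φ k η = 0 :=
  (ρ.mem_X01_iff H η.1).1 η.2

/-- The image under `φ_i` of an intersection of three preimages, one under each elementary map.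
All images needed below are instances of this formula. -/
theorem map_inf_comap (H : Triple i j k) (W U V : Submodule K X) :
    (W.comap (ρ.φ i) ⊓ U.comap (ρ.φ j) ⊓ V.comap (ρ.φ k)).map (ρ.φ i) =
      W ⊓ ρ (y i) ⊓ (U ⊓ ρ (y j) ⊔ V ⊓ ρ (y k)) := by
  ext v
  constructor
  · rintro ⟨η, ⟨⟨hW, hU⟩, hV⟩, rfl⟩
    refine ⟨⟨hW, ρ.φ_mem i η⟩, ?_⟩
    have h : ρ.φ i η = -ρ.φ j η + -ρ.φ k η := by
      rw [← neg_add, eq_neg_iff_add_eq_zero, ← add_assoc]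
      exact ρ.φ_add H η
    rw [h]
    exact Submodule.add_mem_sup (neg_mem ⟨hU, ρ.φ_mem j η⟩) (neg_mem ⟨hV, ρ.φ_mem k η⟩)
  · rintro ⟨⟨hW, hi⟩, hs⟩
    obtain ⟨u, ⟨hU, hj⟩, w, ⟨hV, hk⟩, rfl⟩ := Submodule.mem_sup.1 hs
    have hmem : ∀ t, (if t = i then u + w else if t = j then -u else -w) ∈ ρ (y t) := by
      intro t
      rcases H.eq_or t with rfl | rfl | rfl
      · simpa using hi
      · simpa [H.ne₁₂.symm] using hj
      · simpa [H.ne₁₃.symm, H.ne₂₃.symm] using hk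
    let η : ρ.R := fun t => ⟨_, hmem t⟩
    have ei : (η i : X) = u + w := by simp [η]
    have ej : (η j : X) = -u := by simp [η, H.ne₁₂.symm]
    have ek : (η k : X) = -w := by simp [η, H.ne₁₃.symm, H.ne₂₃.symm]
    have hη : η ∈ ρ.X01 := by
      rw [ρ.mem_X01_iff H, ei, ej, ek]
      abel
    refine ⟨⟨η, hη⟩, ⟨⟨?_, ?_⟩, ?_⟩, ei⟩
    · change (η i : X) ∈ W
      rwa [ei]
    · change (η j : X) ∈ U
      rw [ej]
      exact neg_mem hU
    · change (η k : X) ∈ V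
      rw [ek]
      exact neg_mem hV

/-- `Φ⁺ρ(z)` is the full preimage of `ρ(w)` under `φ_i`. -/
def Pulls (i : Fin 3) (z w : D) : Prop := ρ.coxeter z = (ρ w).comap (ρ.φ i)

/-- The image of `Φ⁺ρ(z)` under `φ_i`. -/
def image (i : Fin 3) (z : D) : Submodule K X := (ρ.coxeter z).map (ρ.φ i)

variable {ρ} {z z₁ z₂ z₃ w w₁ w₂ w₃ : D}

theorem map_top (ρ : Rep K X) : ρ ⊤ = ⊤ := ρ.map_unity

theorem pulls_top : Pulls ρ i ⊤ ⊤ := by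
  rw [Pulls, map_top, map_top, Submodule.comap_top]

theorem pulls_y : Pulls ρ i (y i) (x i) := rfl

theorem coxeter_x (ρ : Rep K X) (i : Fin 3) :
    ρ.coxeter (x i) = (⊥ : Submodule K X).comap (ρ.φ i) := rfl

theorem Pulls.inf (h₁ : Pulls ρ i z₁ w₁) (h₂ : Pulls ρ i z₂ w₂) :
    Pulls ρ i (z₁ ⊓ z₂) (w₁ ⊓ w₂) := by
  rw [Pulls, map_inf, h₁, h₂, map_inf, Submodule.comap_inf]

/-- Only the part of `w` below `y_i` matters for a preimage under `φ_i`. -/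
theorem Pulls.congr (h : Pulls ρ i z w₁) (hw : y i ⊓ w₁ = y i ⊓ w₂) :
    Pulls ρ i z w₂ := by
  have key : ∀ w, (ρ w).comap (ρ.φ i) = (ρ (y i ⊓ w)).comap (ρ.φ i) := by
    intro w
    rw [map_inf]
    ext η
    exact ⟨fun hη => ⟨ρ.φ_mem i η, hη⟩, fun hη => hη.2⟩
  rw [Pulls, h, key, hw, ← key]

theorem comap_sup_of_map_eq {W W' : Submodule K X} {Z : Submodule K ρ.X01}
    (h : Z.map (ρ.φ i) = W') : W.comap (ρ.φ i) ⊔ Z = (W ⊔ W').comap (ρ.φ i) := by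
  subst h
  apply le_antisymm
  · exact sup_le (Submodule.comap_mono le_sup_left)
      ((Submodule.le_comap_map _ _).trans (Submodule.comap_mono le_sup_right))
  · intro η hη
    obtain ⟨u, hu, _, ⟨ζ, hζ, rfl⟩, e⟩ := Submodule.mem_sup.1 (Submodule.mem_comap.1 hη)
    have h₁ : η - ζ ∈ W.comap (ρ.φ i) := by
      rw [Submodule.mem_comap, map_sub, ← e, add_sub_cancel_right]
      exact hu
    simpa using Submodule.add_mem_sup h₁ hζ

theorem Pulls.sup (h₁ : Pulls ρ i z₁ w₁) (h₂ : ρ.image i z₂ = ρ w₂) :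
    Pulls ρ i (z₁ ⊔ z₂) (w₁ ⊔ w₂) := by
  rw [Pulls, map_sup, h₁, map_sup, comap_sup_of_map_eq h₂]

theorem Pulls.x_sup (h : ρ.image i z = ρ w) : Pulls ρ i (x i ⊔ z) w := by
  rw [Pulls, map_sup, coxeter_x, comap_sup_of_map_eq h, bot_sup_eq]

theorem image_inf₃ (H : Triple i j k) (h₁ : Pulls ρ i z₁ w₁) (h₂ : Pulls ρ j z₂ w₂)
    (h₃ : Pulls ρ k z₃ w₃) :
    ρ.image i (z₁ ⊓ z₂ ⊓ z₃) = ρ (w₁ ⊓ y i ⊓ (w₂ ⊓ y j ⊔ w₃ ⊓ y k)) := by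
  simp only [image, map_inf, map_sup]
  rw [h₁, h₂, h₃, map_inf_comap ρ H]

theorem image_inf₂ (H : Triple i j k) (h₂ : Pulls ρ j z₂ w₂) (h₃ : Pulls ρ k z₃ w₃) :
    ρ.image i (z₂ ⊓ z₃) = ρ (y i ⊓ (w₂ ⊓ y j ⊔ w₃ ⊓ y k)) := by
  simpa using image_inf₃ H pulls_top h₂ h₃

theorem image_x_inf (H : Triple i j k) (h₁ : Pulls ρ i z₁ w₁) (h₃ : Pulls ρ k z₃ w₃) :
    ρ.image i (z₁ ⊓ x j ⊓ z₃) = ρ (w₁ ⊓ y i ⊓ (w₃ ⊓ y k)) := by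
  simp only [image, map_inf]
  rw [h₁, coxeter_x, h₃, map_inf_comap ρ H, bot_inf_eq, bot_sup_eq]

theorem image_x (H : Triple i j k) : ρ.image i (x j) = ρ (y i ⊓ y k) := by
  simpa using image_x_inf (z₁ := ⊤) (z₃ := ⊤) H (pulls_top (ρ := ρ)) pulls_top

/-- Under `φ_i` the atomic elements `A_n^{ij}` and `a_n^{ik}` correspond to each other. -/
theorem pulls_A (n : ℕ) : ∀ {i j k : Fin 3}, Triple i j k →
    Pulls ρ i (A i j n) (a i k n) := by
  induction n with
  | zero => exact fun _ => pulls_top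
  | succ n ih =>
    intro i j k H
    rw [H.A_succ, H.rot.swap.a_succ]
    have h : ρ.image i (x j ⊓ A k i n) = ρ (y i ⊓ (a k j n ⊓ y k)) := by
      simpa using image_x_inf H (pulls_top (ρ := ρ)) (ih H.rot.rot)
    refine (pulls_y.sup h).congr ?_
    rw [inf_sup_of_le_left (x_le_y i), inf_sup_of_le_left (x_le_y i), ← inf_assoc, inf_idem,
      inf_comm (y k)]

/-- Under `φ_i` the atomic elements `a_n^{ij}` and `A_n^{kj}` correspond to each other. -/
theorem pulls_a (n : ℕ) : ∀ {i j k : Fin 3}, Triple i j k →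
    Pulls ρ i (a i j n) (A k j n) := by
  induction n with
  | zero => exact fun _ => pulls_top
  | succ n ih =>
    intro i j k H
    rw [H.a_succ, H.swap.A_succ]
    have h := image_inf₂ H (pulls_y.inf (ih H.rot)) (pulls_top (ρ := ρ))
    rw [inf_top_eq] at h
    refine (Pulls.x_sup h).congr ?_
    rw [← inf_assoc, inf_idem, top_inf_eq, inf_right_comm, inf_eq_left.2 (x_le_y j), sup_comm]

end Rep

/-! ### The admissible elements in a uniform notation -/

/-- A triple of elements `f_α`, `e_α`, `g_{α0}`. -/
@[ext]
structure Elements where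
  /-- The element `f_α`. -/
  f : D
  /-- The element `e_α`. -/
  e : D
  /-- The element `g_{α0}`. -/
  g : D

/-- The elements for a sequence with last index `h`, a major step from `h` leading to `n` and a
minor one to `p`, when there are `2r` major and `2m` minor steps.

Here, and in `oddOdd`, the last factor of `g` differs from the one in the table: it is chosen to
contain `x_p`, so that it becomes a full preimage under `φ_p`. -/
def evenEven (p h n : Fin 3) (r m : ℕ) : Elements where
  f := x h ⊓ A n p r ⊓ a n p m
  e := y h ⊓ a h n m ⊓ A n p r ⊓ a n p m ⊓ A p h r
  g := y h ⊓ a h n m ⊓ A n p r ⊓ a n p m ⊓ A p h r ⊓ (y p ⊓ a p h m ⊔ y n ⊓ A h n r)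

/-- The elements as in `evenEven`, for `2q + 1` major and `2m` minor steps. -/
def oddEven (p h n : Fin 3) (q m : ℕ) : Elements where
  f := y h ⊓ y n ⊓ a h p q ⊓ A p n m
  e := y h ⊓ A n h m ⊓ a h p q ⊓ A p n m ⊓ a p n (q + 1)
  g := y h ⊓ A n h m ⊓ a h p q ⊓ A p n m ⊓ a p n (q + 1) ⊓ (x h ⊔ a p n q ⊓ A p n (m + 1))

/-- The elements as in `evenEven`, for `2q` major and `2m + 1` minor steps. -/
def evenOdd (p h n : Fin 3) (q m : ℕ) : Elements where
  f := y p ⊓ y h ⊓ a p n q ⊓ A n h m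
  e := y h ⊓ A n h m ⊓ a h p q ⊓ A p n (m + 1) ⊓ a p n q
  g := y h ⊓ A n h m ⊓ a h p q ⊓ A p n (m + 1) ⊓ a p n q ⊓ (x p ⊔ a n h q ⊓ A n h (m + 1))

/-- The elements as in `evenEven`, for `2q + 1` major and `2m + 1` minor steps. -/
def oddOdd (p h n : Fin 3) (q m : ℕ) : Elements where
  f := y h ⊓ (x n ⊔ x p) ⊓ A p h q ⊓ a h n m
  e := y h ⊓ a h n m ⊓ A n p (q + 1) ⊓ a n p (m + 1) ⊓ A p h q
  g := y h ⊓ a h n m ⊓ A n p (q + 1) ⊓ a n p (m + 1) ⊓ A p h q ⊓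
    (A p h (q + 1) ⊔ y h ⊓ (y n ⊓ a n p m))

/-! ### Identities between the factors of admissible elements -/

section Identities

section Abstract

variable {L : Type*} [Lattice L] [IsModularLattice L] {s t u c d b w : L}

theorem inf_inf_sup_inf_of_le (hs : s ≤ t) (hc : s ≤ c) : s ⊓ d ⊓ t ⊔ c ⊓ u = c ⊓ (u ⊔ s ⊓ d) := by
  rw [inf_right_comm, inf_eq_left.2 hs, inf_sup_of_le_right (inf_le_left.trans hc), sup_comm]

theorem inf_inf_sup_inf_of_le' (hs : s ≤ t) (hu : u ≤ d) :
    s ⊓ d ⊓ t ⊔ b ⊓ u = d ⊓ (s ⊔ u ⊓ b) := by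
  rw [inf_right_comm, inf_eq_left.2 hs, inf_sup_of_le_right (inf_le_left.trans hu), inf_comm s,
    inf_comm b]

/-- The form in which the factor `w` of `g_{α0} = e_α w` passes through an image formula. -/
theorem inf_inf_sup_inf_inf_of_le (hs : s ≤ t) (hu : u ≤ d) (hw : s ≤ w) (hv : u ⊓ c = u ⊓ w) :
    s ⊓ d ⊓ t ⊔ b ⊓ c ⊓ u = d ⊓ (s ⊔ u ⊓ b) ⊓ w := by
  have hb : b ⊓ c ⊓ u = b ⊓ w ⊓ u := by rw [inf_assoc, inf_comm c, hv, inf_comm u, ← inf_assoc]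
  rw [hb, inf_inf_sup_inf_of_le' hs hu, inf_assoc d, sup_inf_of_le_left hw, inf_assoc u]

end Abstract

variable {p h n : Fin 3}

/-- The last factor of `g_{α0}` as listed in the table for even step numbers, the major one
positive, agrees with the one in `evenEven`. -/
theorem evenEven_factor (H : Triple p h n) (q m : ℕ) :
    y n ⊓ y h ⊔ A p h q ⊓ a n p (m + 1) = y p ⊓ a p h m ⊔ y n ⊓ A h n (q + 1) := by
  rw [H.rot.rot.a_succ, H.rot.A_succ, inf_sup_of_le_right (inf_le_left.trans (y_le_A p h q)),
    inf_sup_of_le_right (inf_le_left.trans (x_le_y n)), inf_comm (x n)]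
  ac_rfl

/-- The last factor of `g_{α0}` as listed in the table for equal even step numbers agrees with
the one in `evenEven` below `A_m^{ph}`, which is a factor of `e_α`. -/
theorem evenEven_factor_diag (H : Triple p h n) (m : ℕ) :
    A p h m ⊓ (y n ⊓ a n h m ⊔ y p ⊓ a p h m) = A p h m ⊓ (y p ⊓ a p h m ⊔ y n ⊓ A h n m) := by
  cases m with
  | zero => simp [a_zero, A_zero, sup_comm]
  | succ m =>
    have hle : y n ⊓ y h ⊓ a h p m ≤ A p h m := by
      rw [← inf_A_eq_inf_a m H.swap]
      exact inf_le_right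
    have hp : y p ⊓ a p h (m + 1) ≤ A p h m := inf_le_left.trans (y_le_A p h m)
    have key : A p h m ⊓ (y n ⊓ a n h (m + 1) ⊔ y p ⊓ a p h (m + 1)) =
        A p h m ⊓ (y p ⊓ a p h (m + 1) ⊔ y n ⊓ A h n (m + 1)) := by
      rw [inf_sup_of_le_right hp, inf_sup_of_le_left hp, H.swap.a_succ, H.rot.A_succ,
        inf_sup_of_le_left (x_le_y n), inf_sup_of_le_right (inf_le_left.trans (x_le_y n)),
        ← inf_assoc, inf_sup_of_le_right hle, inf_sup_of_le_right inf_le_right,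
        ← inf_A_eq_inf_a m H.swap]
      ac_rfl
    rw [← inf_eq_left.2 (A_succ_le m p h), inf_assoc, key, inf_assoc]

/-- The last factor in `evenEven` is the preimage under `φ_p` of the left side; on the right stands
the last factor for the sequences that are one step longer, cut down to `y_p`. -/
theorem evenEven_pull (H : Triple p h n) (r m : ℕ) :
    x p ⊓ A n h m ⊔ y p ⊓ (x n ⊓ y n ⊔ a h p r ⊓ y h) =
      y p ⊓ (x n ⊔ a h p r ⊓ A h p (m + 1)) := by
  rw [H.swap.rot.A_succ, inf_sup_of_le_right (inf_le_left.trans (x_le_a_right h p r)),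
    ← sup_assoc, inf_sup_of_le_right (inf_le_left.trans (x_le_y p)), inf_eq_left.2 (x_le_y n),
    sup_comm]

/-- The last factor of `g_{α0}` as listed in the table, for odd step numbers, may be replaced by one
that contains `x_p`, hence is a full preimage under `φ_p`. -/
theorem oddOdd_factor (H : Triple p h n) (q m : ℕ) :
    y h ⊓ (y p ⊓ y h ⊔ A n p q ⊓ a h n (m + 1)) =
      y h ⊓ (A p h (q + 1) ⊔ y h ⊓ (y n ⊓ a n p m)) := by
  have hx : x h ⊓ A n p q ≤ y h := inf_le_left.trans (x_le_y h)
  rw [H.rot.a_succ, H.A_succ, inf_sup_of_le_right (inf_le_left.trans (y_le_A n p q)),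
    inf_sup_of_le_right inf_le_left, inf_sup_of_le_right hx, inf_comm (A n p q), ← sup_assoc,
    inf_sup_of_le_left (sup_le inf_le_right hx), inf_comm (y p)]

/-- The last factor of `g_{α0}` as listed in the table for equal odd step numbers agrees with
the one in `oddOdd` below `y_h` and `A_m^{np}`, which contain `e_α`. -/
theorem oddOdd_factor_diag (H : Triple p h n) (m : ℕ) :
    y h ⊓ A n p m ⊓ (y h ⊓ a h n (m + 1) ⊔ y h ⊓ a h p (m + 1)) =
      y h ⊓ A n p m ⊓ (A p h (m + 1) ⊔ y h ⊓ (y n ⊓ a n p m)) := by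
  have hn : y h ⊓ (y n ⊓ a n p m) ≤ A n p m :=
    inf_le_right.trans (inf_le_left.trans (y_le_A n p m))
  have hQ : y h ⊓ (y p ⊓ A n p m) = y h ⊓ (y p ⊓ a p n m) := by
    rw [← inf_assoc, ← inf_assoc, inf_A_eq_inf_a m H.swap.rot]
  have hp : y h ⊓ (y p ⊓ a p n m) ≤ A n p m := by
    rw [← hQ]
    exact inf_le_right.trans inf_le_right
  have hl : A n p m ⊓ (y h ⊓ a h n (m + 1) ⊔ y h ⊓ a h p (m + 1)) =
      x h ⊓ A n p m ⊔ y h ⊓ (y n ⊓ a n p m) ⊔ y h ⊓ (y p ⊓ a p n m) := by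
    rw [H.rot.a_succ, H.swap.rot.a_succ, inf_sup_of_le_left (x_le_y h),
      inf_sup_of_le_left (x_le_y h), sup_sup_sup_comm, sup_idem, inf_sup_of_le_right (sup_le hn hp),
      inf_comm, sup_assoc]
  have hr : A n p m ⊓ (y h ⊓ (A p h (m + 1) ⊔ y h ⊓ (y n ⊓ a n p m))) =
      x h ⊓ A n p m ⊔ y h ⊓ (y n ⊓ a n p m) ⊔ y h ⊓ (y p ⊓ a p n m) := by
    rw [H.A_succ, inf_sup_of_le_right inf_le_left,
      inf_sup_of_le_right (inf_le_left.trans (x_le_y h)), inf_sup_of_le_right hn,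
      inf_sup_of_le_right inf_le_right, ← hQ]
    ac_rfl
  calc _ = y h ⊓ (A n p m ⊓ (y h ⊓ a h n (m + 1) ⊔ y h ⊓ a h p (m + 1))) := inf_assoc _ _ _
    _ = y h ⊓ (A n p m ⊓ (y h ⊓ (A p h (m + 1) ⊔ y h ⊓ (y n ⊓ a n p m)))) := by rw [hl, hr]
    _ = _ := by rw [inf_left_comm (A n p m), ← inf_assoc (y h) (y h), inf_idem, ← inf_assoc]

/-- The analogue of `evenEven_pull` for a major step from `oddOdd`. -/
theorem oddOdd_pull (H : Triple p h n) (q m : ℕ) :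
    y p ⊓ (a p n (q + 1) ⊔ y p ⊓ (x h ⊓ y h ⊔ x n ⊓ A h p m ⊓ y n)) =
      y p ⊓ (x h ⊔ a p n (q + 1) ⊓ A p n (m + 1)) := by
  have hx : x n ⊓ A h p m ≤ a p n (q + 1) := inf_le_left.trans (x_le_a_right p n _)
  rw [inf_eq_left.2 (x_le_y h), inf_right_comm, inf_eq_left.2 (x_le_y n),
    inf_sup_of_le_right inf_le_left, H.rot.swap.A_succ, inf_sup_of_le_right hx, sup_left_comm,
    inf_sup_of_le_left inf_le_right, inf_comm (y p) (a p n _)]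

/-- The analogue of `evenEven_pull` for a minor step from `oddOdd`. -/
theorem oddOdd_pull' (H : Triple p h n) (q m : ℕ) :
    a p n (q + 1) ⊔ y p ⊓ (x h ⊓ y h ⊔ x n ⊓ A h p m ⊓ y n) =
      x p ⊔ a n h q ⊓ A n h (m + 2) := by
  have hx : x n ⊓ A h p m ≤ a p n (q + 1) := inf_le_left.trans (x_le_a_right p n _)
  have hh : x h ⊓ A p n (m + 1) ≤ a n h q := inf_le_left.trans (x_le_a_right n h _)
  have h₁ : x p ⊔ a n h q ⊓ A n h (m + 2) = a p n (q + 1) ⊔ x h ⊓ A p n (m + 1) := by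
    rw [H.swap.A_succ (m + 1), inf_sup_of_le_right hh, ← sup_assoc, H.rot.swap.a_succ,
      inf_comm (y n)]
  rw [h₁, H.rot.swap.A_succ, inf_eq_left.2 (x_le_y h), inf_right_comm,
    inf_eq_left.2 (x_le_y n), ← sup_eq_left.2 hx, sup_assoc, sup_assoc]
  congr 1
  rw [← sup_inf_of_le_left (le_sup_right : x n ⊓ A h p m ≤ x h ⊔ x n ⊓ A h p m),
    ← sup_inf_of_le_left (le_sup_right : x n ⊓ A h p m ≤ y p ⊔ x n ⊓ A h p m)]
  ac_rfl

end Identities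

/-! ### The elementary maps on admissible elements -/

namespace Rep

variable {K X : Type*} [Field K] [AddCommGroup X] [Module K X]

/-- The map `φ_i` sends the values of `E` at `Φ⁺ρ` to the values of `E'` at `ρ`. -/
structure Carries (ρ : Rep K X) (i : Fin 3) (E E' : Elements) : Prop where
  f : ρ.image i E.f = ρ E'.f
  e : ρ.image i E.e = ρ E'.e
  g : ρ.image i E.g = ρ E'.g

variable {ρ : Rep K X} {p h n i j k : Fin 3} {z z₁ z₂ z₃ w w₁ w₂ w₃ : D}

theorem image_eq_of_inf₃ (H : Triple i j k) (h₁ : Pulls ρ i z₁ w₁) (h₂ : Pulls ρ j z₂ w₂)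
    (h₃ : Pulls ρ k z₃ w₃) (hz : z = z₁ ⊓ z₂ ⊓ z₃)
    (hw : w = w₁ ⊓ y i ⊓ (w₂ ⊓ y j ⊔ w₃ ⊓ y k)) : ρ.image i z = ρ w := by
  rw [hz, hw, image_inf₃ H h₁ h₂ h₃]

theorem carries_evenEven_major (H : Triple p h n) (r m : ℕ) :
    ρ.Carries n (evenEven p h n r m) (oddEven h n p r m) := by
  have hn := (pulls_A (ρ := ρ) r H.rot.rot).inf (pulls_a m H.rot.rot)
  have hh := (pulls_y (ρ := ρ)).inf (pulls_a m H.rot)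
  have hp := pulls_A (ρ := ρ) r H
  have hW := ((pulls_y (ρ := ρ)).inf (pulls_a m H)).sup
    (image_inf₂ H.rot.swap (pulls_y (ρ := ρ)) (pulls_A r H.rot))
  refine ⟨?_, image_eq_of_inf₃ H.swap hn hh hp ?_ ?_,
    image_eq_of_inf₃ H.swap hn hh (hp.inf hW) ?_ ?_⟩
  · have h := image_x_inf H.swap hn (pulls_top (ρ := ρ))
    rw [inf_top_eq, top_inf_eq] at h
    convert h using 2 <;> simp only [evenEven, oddEven] <;> ac_rfl
  · simp only [evenEven]
    ac_rfl
  · rw [inf_inf_sup_inf_of_le' (x_le_y h) (y_le_A p n m), ← H.swap.rot.a_succ]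
    simp only [oddEven]
    ac_rfl
  · simp only [evenEven]
    ac_rfl
  · rw [evenEven_pull H, inf_inf_sup_inf_inf_of_le (x_le_y h) (y_le_A p n m)
      (w := x n ⊔ a h p r ⊓ A h p (m + 1)) ?_ ?_, ← H.swap.rot.a_succ]
    · simp only [oddEven]
      ac_rfl
    · exact le_sup_of_le_right (le_inf (x_le_a _ _ _) (x_le_A _ _ _))
    · rw [← inf_assoc, inf_idem]

theorem carries_evenEven_minor (H : Triple p h n) (r m : ℕ) :
    ρ.Carries p (evenEven p h n r m) (evenOdd n p h r m) := by
  have hn := (pulls_A (ρ := ρ) r H.rot.rot).inf (pulls_a m H.rot.rot)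
  have hh := (pulls_y (ρ := ρ)).inf (pulls_a m H.rot)
  have hp := pulls_A (ρ := ρ) r H
  have hW := ((pulls_y (ρ := ρ)).inf (pulls_a m H)).sup
    (image_inf₂ H.rot.swap (pulls_y (ρ := ρ)) (pulls_A r H.rot))
  have hx : x h ≤ a n h r ⊓ A h p m := le_inf (x_le_a_right _ _ _) (x_le_A _ _ _)
  refine ⟨?_, image_eq_of_inf₃ H hp hh hn ?_ ?_,
    image_eq_of_inf₃ H (hp.inf hW) hh hn ?_ ?_⟩
  · have h := image_x_inf H (pulls_top (ρ := ρ)) hn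
    rw [top_inf_eq, top_inf_eq] at h
    convert h using 2 <;> simp only [evenEven, evenOdd] <;> ac_rfl
  · simp only [evenEven]
    ac_rfl
  · rw [inf_inf_sup_inf_of_le (x_le_y h) hx, ← H.swap.A_succ]
    simp only [evenOdd]
    ac_rfl
  · simp only [evenEven]
    ac_rfl
  · rw [evenEven_pull H, inf_inf_sup_inf_of_le (x_le_y h) hx, ← H.swap.A_succ]
    simp only [evenOdd]
    ac_rfl

theorem carries_oddEven_major (H : Triple p h n) (q m : ℕ) :
    ρ.Carries n (oddEven p h n q m) (evenEven h n p (q + 1) m) := by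
  have hn := pulls_A (ρ := ρ) m H.swap
  have hh := (pulls_y (ρ := ρ)).inf (pulls_a q H.swap.rot)
  have hp := pulls_A (ρ := ρ) m H.rot.swap
  have hp' := pulls_a (ρ := ρ) (q + 1) H.rot.swap
  have hW := ((pulls_a (ρ := ρ) q H.rot.swap).inf (pulls_A (m + 1) H.rot.swap)).sup
    (image_x H)
  rw [sup_comm _ (x h)] at hW
  refine ⟨image_eq_of_inf₃ H.swap pulls_y hh hp ?_ ?_,
    image_eq_of_inf₃ H.swap hn hh (hp.inf hp') ?_ ?_,
    image_eq_of_inf₃ H.swap hn hh ((hp.inf hp').inf hW) ?_ ?_⟩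
  · simp only [oddEven]
    ac_rfl
  · rw [inf_inf_sup_inf_of_le (x_le_y h) (x_le_a_right p h m), ← H.A_succ,
      inf_eq_left.2 (x_le_y n)]
    simp only [evenEven]
    ac_rfl
  · simp only [oddEven]
    ac_rfl
  · rw [inf_inf_sup_inf_of_le (x_le_y h) (le_inf (x_le_a_right p h m) (x_le_A _ _ _)), ← H.A_succ]
    simp only [evenEven]
    ac_rfl
  · simp only [oddEven]
    ac_rfl
  · rw [inf_inf_sup_inf_of_le (x_le_y h) (le_inf (le_inf (x_le_a_right p h m) (x_le_A _ _ _))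
      (le_sup_of_le_left (le_inf (x_le_A _ _ _) (x_le_a_right _ _ _)))), ← H.A_succ,
      sup_comm (A h n q ⊓ _), evenEven_factor H.rot]
    simp only [evenEven]
    ac_rfl

theorem carries_oddEven_minor (H : Triple p h n) (q m : ℕ) :
    ρ.Carries p (oddEven p h n q m) (oddOdd n p h q m) := by
  have hn := pulls_A (ρ := ρ) m H.swap
  have hh := (pulls_y (ρ := ρ)).inf (pulls_a q H.swap.rot)
  have hp := pulls_A (ρ := ρ) m H.rot.swap
  have hp' := pulls_a (ρ := ρ) (q + 1) H.rot.swap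
  have hW := ((pulls_a (ρ := ρ) q H.rot.swap).inf (pulls_A (m + 1) H.rot.swap)).sup
    (image_x H)
  rw [sup_comm _ (x h)] at hW
  refine ⟨image_eq_of_inf₃ H hp hh pulls_y ?_ ?_,
    image_eq_of_inf₃ H (hp.inf hp') hh hn ?_ ?_,
    image_eq_of_inf₃ H ((hp.inf hp').inf hW) hh hn ?_ ?_⟩
  · simp only [oddEven]
    ac_rfl
  · have key := inf_inf_sup_inf_of_le' (b := x n) (x_le_y h) (y_le_A n p q)
    rw [inf_comm (y n)] at key
    rw [key, inf_eq_left.2 (x_le_y n)]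
    simp only [oddOdd]
    ac_rfl
  · simp only [oddEven]
    ac_rfl
  · rw [inf_inf_sup_inf_of_le' (x_le_y h) (y_le_A n p q), ← H.rot.a_succ]
    simp only [oddOdd]
    ac_rfl
  · simp only [oddEven]
    ac_rfl
  · have hV := oddOdd_factor H.rot.rot q m
    rw [inf_inf_sup_inf_of_le' (x_le_y h) (y_le_A n p q), ← H.rot.a_succ,
      inf_assoc _ _ (y p), inf_comm _ (y p), sup_comm (A h n q ⊓ _), inf_comm (y p) (y n), hV]
    simp only [oddOdd]
    ac_rfl

theorem carries_evenOdd_major (H : Triple p h n) (q m : ℕ) :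
    ρ.Carries n (evenOdd p h n q m) (oddOdd h n p q m) := by
  have hn := pulls_A (ρ := ρ) m H.swap
  have hh := (pulls_y (ρ := ρ)).inf (pulls_a q H.swap.rot)
  have hp := (pulls_A (ρ := ρ) (m + 1) H.rot.swap).inf (pulls_a q H.rot.swap)
  have hW := ((pulls_a (ρ := ρ) q H.swap).inf (pulls_A (m + 1) H.swap)).sup
    (image_x H.rot.rot)
  rw [sup_comm _ (x p)] at hW
  refine ⟨image_eq_of_inf₃ H.swap hn pulls_y (pulls_y.inf (pulls_a q H.rot.swap)) ?_ ?_,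
    image_eq_of_inf₃ H.swap hn hh hp ?_ ?_,
    image_eq_of_inf₃ H.swap (hn.inf hW) hh hp ?_ ?_⟩
  · simp only [evenOdd]
    ac_rfl
  · rw [inf_eq_left.2 (x_le_y h), inf_right_comm (x p), inf_eq_left.2 (x_le_y p), inf_comm (x p),
      ← inf_sup_of_le_left (x_le_A h n q), sup_comm (x h)]
    simp only [oddOdd]
    ac_rfl
  · simp only [evenOdd]
    ac_rfl
  · rw [inf_inf_sup_inf_of_le (x_le_y h) (le_inf (x_le_a_right _ _ _) (x_le_A _ _ _)), ← H.A_succ]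
    simp only [oddOdd]
    ac_rfl
  · simp only [evenOdd]
    ac_rfl
  · have hV := oddOdd_factor H.rot q m
    rw [inf_inf_sup_inf_of_le (x_le_y h) (le_inf (x_le_a_right _ _ _) (x_le_A _ _ _)), ← H.A_succ,
      inf_assoc _ _ (y n), inf_comm _ (y n), sup_comm (A p h q ⊓ _), inf_comm (y n) (y h), hV]
    simp only [oddOdd]
    ac_rfl

theorem carries_evenOdd_minor (H : Triple p h n) (q m : ℕ) :
    ρ.Carries p (evenOdd p h n q m) (evenEven n p h q (m + 1)) := by
  have hn := pulls_A (ρ := ρ) m H.swap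
  have hh := (pulls_y (ρ := ρ)).inf (pulls_a q H.swap.rot)
  have hp := (pulls_A (ρ := ρ) (m + 1) H.rot.swap).inf (pulls_a q H.rot.swap)
  have hW := Pulls.x_sup (image_inf₂ H (pulls_top (ρ := ρ))
    ((pulls_a (ρ := ρ) q H.swap).inf (pulls_A (m + 1) H.swap)))
  simp only [top_inf_eq] at hW
  refine ⟨image_eq_of_inf₃ H (pulls_y.inf (pulls_a q H.rot.swap)) pulls_y hn ?_ ?_,
    image_eq_of_inf₃ H hp hh hn ?_ ?_,
    image_eq_of_inf₃ H (hp.inf hW) hh hn ?_ ?_⟩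
  · simp only [evenOdd]
    ac_rfl
  · rw [inf_eq_left.2 (x_le_y h), inf_right_comm (x p), inf_eq_left.2 (x_le_y p),
      inf_comm (a n p m), ← H.rot.a_succ]
    rfl
  · simp only [evenOdd]
    ac_rfl
  · rw [inf_inf_sup_inf_of_le' (x_le_y h) (y_le_A n p q), ← H.rot.a_succ]
    simp only [evenEven]
    ac_rfl
  · simp only [evenOdd]
    ac_rfl
  · have hV : y p ⊓ (y h ⊔ A p h q ⊓ a n p (m + 1) ⊓ y n) =
        y p ⊓ (y n ⊓ a n p (m + 1) ⊔ y h ⊓ A p h q) := by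
      have hA : A p h q ⊓ (y h ⊔ A p h q ⊓ a n p (m + 1) ⊓ y n) =
          A p h q ⊓ (y n ⊓ a n p (m + 1) ⊔ y h ⊓ A p h q) := by
        rw [inf_sup_of_le_right (inf_le_left.trans inf_le_left), inf_sup_of_le_right inf_le_right]
        ac_rfl
      rw [← inf_eq_left.2 (y_le_A p h q), inf_assoc (y p), hA, ← inf_assoc (y p)]
    rw [inf_inf_sup_inf_of_le' (x_le_y h) (y_le_A n p q), ← H.rot.a_succ, hV]
    simp only [evenEven]
    ac_rfl

theorem carries_oddOdd_major (H : Triple p h n) (q m : ℕ) :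
    ρ.Carries n (oddOdd p h n q m) (evenOdd h n p (q + 1) m) := by
  have hn := (pulls_A (ρ := ρ) (q + 1) H.rot.rot).inf (pulls_a (m + 1) H.rot.rot)
  have hh := (pulls_y (ρ := ρ)).inf (pulls_a m H.rot)
  have hp := pulls_A (ρ := ρ) q H
  have hZ := (pulls_A (ρ := ρ) (q + 1) H).sup
    (image_inf₂ H (pulls_y (ρ := ρ)) (pulls_y.inf (pulls_a m H.rot.rot)))
  refine ⟨image_eq_of_inf₃ H.swap (Pulls.x_sup (image_x H.rot.rot)) hh hp ?_ ?_,
    image_eq_of_inf₃ H.swap hn hh hp ?_ ?_,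
    image_eq_of_inf₃ H.swap hn hh (hp.inf hZ) ?_ ?_⟩
  · simp only [oddOdd]
    ac_rfl
  · rw [inf_inf_sup_inf_of_le' (x_le_y h) (y_le_A p n m), ← H.swap.rot.a_succ,
      inf_right_comm (y n), inf_idem]
    simp only [evenOdd]
    ac_rfl
  · simp only [oddOdd]
    ac_rfl
  · rw [inf_inf_sup_inf_of_le' (x_le_y h) (y_le_A p n m), ← H.swap.rot.a_succ]
    simp only [evenOdd]
    ac_rfl
  · simp only [oddOdd]
    ac_rfl
  · rw [inf_inf_sup_inf_inf_of_le (x_le_y h) (y_le_A p n m) le_sup_left (oddOdd_pull H q m),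
      ← H.swap.rot.a_succ]
    simp only [evenOdd]
    ac_rfl

theorem carries_oddOdd_minor (H : Triple p h n) (q m : ℕ) :
    ρ.Carries p (oddOdd p h n q m) (oddEven n p h q (m + 1)) := by
  have hn := (pulls_A (ρ := ρ) (q + 1) H.rot.rot).inf (pulls_a (m + 1) H.rot.rot)
  have hh := (pulls_y (ρ := ρ)).inf (pulls_a m H.rot)
  have hp := pulls_A (ρ := ρ) q H
  have hZ := (pulls_A (ρ := ρ) (q + 1) H).sup
    (image_inf₂ H (pulls_y (ρ := ρ)) (pulls_y.inf (pulls_a m H.rot.rot)))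
  have hx : x h ≤ a n h (q + 1) ⊓ A h p (m + 1) := le_inf (x_le_a_right _ _ _) (x_le_A _ _ _)
  refine ⟨image_eq_of_inf₃ H ((Pulls.x_sup (image_x H.swap.rot.rot)).inf hp) hh pulls_top ?_ ?_,
    image_eq_of_inf₃ H hp hh hn ?_ ?_,
    image_eq_of_inf₃ H (hp.inf hZ) hh hn ?_ ?_⟩
  · rw [sup_comm, inf_top_eq]
    simp only [oddOdd]
    ac_rfl
  · rw [inf_inf_sup_inf_of_le (x_le_y h) le_top, ← H.swap.A_succ, top_inf_eq,
      inf_comm _ (y p), ← inf_assoc (y p), ← inf_assoc (y p), inf_idem]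
    simp only [oddEven]
  · simp only [oddOdd]
    ac_rfl
  · rw [inf_inf_sup_inf_of_le (x_le_y h) hx, ← H.swap.A_succ]
    simp only [oddEven]
    ac_rfl
  · simp only [oddOdd]
    ac_rfl
  · rw [inf_inf_sup_inf_of_le (x_le_y h) hx, ← H.swap.A_succ, oddOdd_pull' H]
    simp only [oddEven]
    ac_rfl

end Rep

/-! ### Arbitrary step numbers -/

/-- The elements for last index `h` after `N` major and `M` minor steps: a major step goes from `h`
to `n`, a minor step from `h` to `p`. -/
def elements (p h n : Fin 3) (N M : ℕ) : Elements :=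
  if Even N then
    if Even M then evenEven p h n (N / 2) (M / 2) else evenOdd p h n (N / 2) (M / 2)
  else
    if Even M then oddEven p h n (N / 2) (M / 2) else oddOdd p h n (N / 2) (M / 2)

section Parity

variable (p h n : Fin 3) (q m : ℕ)

theorem two_mul_add_one_div_two : (2 * q + 1) / 2 = q := by lia

theorem elements_even_even : elements p h n (2 * q) (2 * m) = evenEven p h n q m := by
  simp [elements]

theorem elements_even_odd : elements p h n (2 * q) (2 * m + 1) = evenOdd p h n q m := by
  simp [elements, two_mul_add_one_div_two]

theorem elements_odd_even : elements p h n (2 * q + 1) (2 * m) = oddEven p h n q m := by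
  simp [elements, two_mul_add_one_div_two]

theorem elements_odd_odd : elements p h n (2 * q + 1) (2 * m + 1) = oddOdd p h n q m := by
  simp [elements, two_mul_add_one_div_two]

end Parity

namespace Rep

variable {K : Type*} {X : Type u} [Field K] [AddCommGroup X] [Module K X]

theorem carries_major (ρ : Rep K X) {p h n : Fin 3} (H : Triple p h n) (N M : ℕ) :
    ρ.Carries n (elements p h n N M) (elements h n p (N + 1) M) := by
  obtain ⟨q, rfl | rfl⟩ := Nat.even_or_odd' N <;> obtain ⟨m, rfl | rfl⟩ := Nat.even_or_odd' M
  · rw [elements_even_even, elements_odd_even]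
    exact carries_evenEven_major H q m
  · rw [elements_even_odd, elements_odd_odd]
    exact carries_evenOdd_major H q m
  · rw [elements_odd_even, add_assoc, ← Nat.mul_succ, elements_even_even]
    exact carries_oddEven_major H q m
  · rw [elements_odd_odd, add_assoc, ← Nat.mul_succ, elements_even_odd]
    exact carries_oddOdd_major H q m

theorem carries_minor (ρ : Rep K X) {p h n : Fin 3} (H : Triple p h n) (N M : ℕ) :
    ρ.Carries p (elements p h n N M) (elements n p h N (M + 1)) := by
  obtain ⟨q, rfl | rfl⟩ := Nat.even_or_odd' N <;> obtain ⟨m, rfl | rfl⟩ := Nat.even_or_odd' M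
  · rw [elements_even_even, elements_even_odd]
    exact carries_evenEven_minor H q m
  · rw [elements_even_odd, add_assoc, ← Nat.mul_succ, elements_even_even]
    exact carries_evenOdd_minor H q m
  · rw [elements_odd_even, elements_odd_odd]
    exact carries_oddEven_minor H q m
  · rw [elements_odd_odd, add_assoc, ← Nat.mul_succ, elements_odd_even]
    exact carries_oddOdd_minor H q m

/-! ### Symmetry for equally many steps in both directions -/

/-- `E` and `E'` have the same values at `ρ`. -/
structure Agree (ρ : Rep K X) (E E' : Elements) : Prop where
  f : ρ E.f = ρ E'.f
  e : ρ E.e = ρ E'.e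
  g : ρ E.g = ρ E'.g

variable {ρ : Rep K X}

theorem Agree.refl (E : Elements) : Agree ρ E E := ⟨rfl, rfl, rfl⟩

theorem Agree.symm {E E' : Elements} (h : Agree ρ E E') : Agree ρ E' E :=
  ⟨h.f.symm, h.e.symm, h.g.symm⟩

theorem Carries.congr {i : Fin 3} {E E' E₁ E₁' : Elements} (h : ρ.Carries i E E')
    (hE : Agree ρ.coxeter E₁ E) (hE' : Agree ρ E₁' E') : ρ.Carries i E₁ E₁' where
  f := by rw [image, hE.f, hE'.f, ← h.f, image]
  e := by rw [image, hE.e, hE'.e, ← h.e, image]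
  g := by rw [image, hE.g, hE'.g, ← h.g, image]

theorem map_map_eq_of_add_eq_zero {U V W : Type*} [AddCommGroup U] [Module K U] [AddCommGroup V]
    [Module K V] [AddCommGroup W] [Module K W] {f₁ f₂ : U →ₗ[K] V} {g : V →ₗ[K] W}
    {Z : Submodule K U} (h : ∀ ζ ∈ Z, g (f₁ ζ) + g (f₂ ζ) = 0) :
    (Z.map f₁).map g = (Z.map f₂).map g := by
  rw [← Submodule.map_comp, ← Submodule.map_comp, ← Submodule.map_neg Z (g ∘ₗ f₂)]
  ext v
  simp only [Submodule.mem_map]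
  refine exists_congr fun ζ => and_congr_right fun hζ => ?_
  have e : (g ∘ₗ f₁) ζ = (-(g ∘ₗ f₂)) ζ := eq_neg_of_add_eq_zero_left (h ζ hζ)
  rw [e]

theorem image_congr {i : Fin 3} {z z' : D} (h : ρ.coxeter z = ρ.coxeter z') :
    ρ.image i z = ρ.image i z' := by
  rw [image, image, h]

theorem map_image_eq_of_le_ker {W : Type*} [AddCommGroup W] [Module K W] {h i j : Fin 3}
    (H : Triple h i j) {g : X →ₗ[K] W} (hg : ρ (x h) ≤ LinearMap.ker g) {z : D} (hz : z ≤ y h) :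
    (ρ.image i z).map g = (ρ.image j z).map g := by
  refine map_map_eq_of_add_eq_zero fun ζ hζ => ?_
  have hy : ρ.coxeter z ≤ ρ.coxeter (y h) := OrderHomClass.mono ρ.coxeter.toLatticeHom hz
  have h₁ : g (ρ.φ h ζ) = 0 := hg (hy hζ)
  have h₂ := congrArg g (ρ.φ_add H ζ)
  rwa [map_add, map_add, h₁, zero_add, map_zero] at h₂

/-- The relation `φ_h φ_i = -φ_h φ_j` on the part of the twofold functor below `y_h`: there
`φ_h φ_h` vanishes, and `φ_h + φ_i + φ_j = 0`.  It reflects the identification of the sequences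
`…hih…` and `…hjh…`. -/
theorem map_image_eq {h i j : Fin 3} (H : Triple h i j) {z : D} (hz : z ≤ y h) :
    (ρ.coxeter.image i z).map (ρ.φ h) = (ρ.coxeter.image j z).map (ρ.φ h) :=
  map_image_eq_of_le_ker H (g := ρ.φ h) le_rfl hz

theorem elements_le_y (p h n : Fin 3) (N M : ℕ) :
    (elements p h n N M).f ≤ y h ∧ (elements p h n N M).e ≤ y h ∧
      (elements p h n N M).g ≤ y h := by
  obtain ⟨q, rfl | rfl⟩ := Nat.even_or_odd' N <;> obtain ⟨m, rfl | rfl⟩ := Nat.even_or_odd' M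
  · rw [elements_even_even]
    simp only [evenEven, inf_assoc]
    exact ⟨inf_le_left.trans (x_le_y h), inf_le_left, inf_le_left⟩
  · rw [elements_even_odd]
    simp only [evenOdd, inf_assoc]
    exact ⟨inf_le_right.trans inf_le_left, inf_le_left, inf_le_left⟩
  · rw [elements_odd_even]
    simp only [oddEven, inf_assoc]
    exact ⟨inf_le_left, inf_le_left, inf_le_left⟩
  · rw [elements_odd_odd]
    simp only [oddOdd, inf_assoc]
    exact ⟨inf_le_left, inf_le_left, inf_le_left⟩

theorem agree_elements_diag (N : ℕ) : ∀ {X : Type u} [AddCommGroup X] [Module K X] (ρ : Rep K X)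
    {p h n : Fin 3}, Triple p h n → Agree ρ (elements p h n N N) (elements n h p N N) := by
  induction N with
  | zero =>
    intro X _ _ ρ p h n _
    have h₀ : elements p h n 0 0 = elements n h p 0 0 := by
      rw [elements_even_even _ _ _ 0 0, elements_even_even _ _ _ 0 0]
      simp [evenEven, a_zero, A_zero, sup_comm]
    rw [h₀]
    exact Agree.refl _
  | succ N ih =>
    intro X _ _ ρ p h n H
    have key : ∀ {p n : Fin 3}, Triple p h n →
        ρ (elements p h n (N + 1) (N + 1)).f =
          (ρ.coxeter.image n (elements p h n N N).f).map (ρ.φ h) ∧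
        ρ (elements p h n (N + 1) (N + 1)).e =
          (ρ.coxeter.image n (elements p h n N N).e).map (ρ.φ h) ∧
        ρ (elements p h n (N + 1) (N + 1)).g =
          (ρ.coxeter.image n (elements p h n N N).g).map (ρ.φ h) := by
      intro p n H
      have h₁ := ρ.carries_minor H.rot (N + 1) N
      have h₂ := ρ.coxeter.carries_major H N N
      rw [h₂.f, h₂.e, h₂.g]
      exact ⟨h₁.f.symm, h₁.e.symm, h₁.g.symm⟩
    obtain ⟨f₁, e₁, g₁⟩ := key H
    obtain ⟨f₂, e₂, g₂⟩ := key H.swap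
    have hs := ih ρ.coxeter.coxeter H
    obtain ⟨hf, he, hg⟩ := elements_le_y p h n N N
    refine ⟨?_, ?_, ?_⟩
    · rw [f₁, f₂, map_image_eq H.rot hf, image_congr hs.f]
    · rw [e₁, e₂, map_image_eq H.rot he, image_congr hs.e]
    · rw [g₁, g₂, map_image_eq H.rot hg, image_congr hs.g]

end Rep

/-! ### Admissible sequences up to identification -/

/-- `α` starts at `i_1 = s`, ends at `h`, and among its steps `i_{m + 1} - i_m` there are `P` steps
`+1` and `M` steps `-1 = 2`. -/
inductive Walk : List (Fin 3) → Fin 3 → Fin 3 → ℕ → ℕ → Prop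
  | single (s : Fin 3) : Walk [s] s s 0 0
  | plus {α : List (Fin 3)} {s h i : Fin 3} {P M : ℕ} (w : Walk α s h P M) (hi : i = h + 1) :
      Walk (i :: α) s i (P + 1) M
  | minus {α : List (Fin 3)} {s h i : Fin 3} {P M : ℕ} (w : Walk α s h P M) (hi : i = h + 2) :
      Walk (i :: α) s i P (M + 1)

theorem eq_add_one_or_eq_add_two : ∀ {i j : Fin 3}, i ≠ j → i = j + 1 ∨ i = j + 2 := by decide

namespace Walk

variable {α β : List (Fin 3)} {s s' h h' i : Fin 3} {P P' M M' : ℕ}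

theorem exists_eq_cons (w : Walk α s h P M) : ∃ t, α = h :: t := by
  cases w with
  | single => exact ⟨_, rfl⟩
  | plus => exact ⟨_, rfl⟩
  | minus => exact ⟨_, rfl⟩

theorem head_eq (w : Walk (i :: α) s h P M) : i = h := by
  obtain ⟨t, ht⟩ := w.exists_eq_cons
  exact (List.cons.inj ht).1

theorem unique (w : Walk α s h P M) (w' : Walk α s' h' P' M') :
    s = s' ∧ h = h' ∧ P = P' ∧ M = M' := by
  have hne : ∀ {a b : Fin 3}, a = b + 1 → a = b + 2 → False := by decide
  induction w generalizing h' P' M' with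
  | single s =>
    cases w' with
    | single => exact ⟨rfl, rfl, rfl, rfl⟩
    | plus w => cases w
    | minus w => cases w
  | plus w hi ih =>
    cases w' with
    | single => cases w
    | plus w' hi' =>
      obtain ⟨rfl, rfl, rfl, rfl⟩ := ih w'
      exact ⟨rfl, rfl, rfl, rfl⟩
    | minus w' hi' =>
      obtain ⟨-, rfl, -, -⟩ := ih w'
      exact (hne hi hi').elim
  | minus w hi ih =>
    cases w' with
    | single => cases w
    | plus w' hi' =>
      obtain ⟨-, rfl, -, -⟩ := ih w'
      exact (hne hi' hi).elim
    | minus w' hi' =>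
      obtain ⟨rfl, rfl, rfl, rfl⟩ := ih w'
      exact ⟨rfl, rfl, rfl, rfl⟩

theorem of_admissible : ∀ {α : List (Fin 3)}, Admissible α → ∃ s h P M, Walk α s h P M
  | [], hα => (hα.1 rfl).elim
  | [s], _ => ⟨s, s, 0, 0, single s⟩
  | i :: j :: α, hα => by
    have hc := List.isChain_cons_cons.1 hα.2
    obtain ⟨s, h, P, M, w⟩ := of_admissible (α := j :: α) ⟨List.cons_ne_nil _ _, hc.2⟩
    obtain rfl := w.head_eq
    rcases eq_add_one_or_eq_add_two hc.1 with e | e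
    · exact ⟨s, i, P + 1, M, w.plus e⟩
    · exact ⟨s, i, P, M + 1, w.minus e⟩

theorem val_head (w : Walk α s h P M) : (h : ℕ) = (s + P + 2 * M) % 3 := by
  induction w with
  | single s => lia
  | plus w hi ih =>
    rw [hi, Fin.val_add, ih]
    change (_ + 1) % 3 = _
    lia
  | minus w hi ih =>
    rw [hi, Fin.val_add, ih]
    change (_ + 2) % 3 = _
    lia

theorem head_unique (w : Walk α s h P M) (w' : Walk β s h' P M) : h = h' :=
  Fin.ext (w.val_head.trans w'.val_head.symm)

theorem exists_walk (s : Fin 3) (P M : ℕ) : ∃ α h, Walk α s h P M := by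
  induction P with
  | zero =>
    induction M with
    | zero => exact ⟨_, _, single s⟩
    | succ M ih =>
      obtain ⟨α, h, w⟩ := ih
      exact ⟨_, _, w.minus rfl⟩
  | succ P ih =>
    obtain ⟨α, h, w⟩ := ih
    exact ⟨_, _, w.plus rfl⟩

/-- A replacement `…iji… = …iki…` exchanges two adjacent steps of opposite directions. -/
theorem step (hs : Step α β) (w : Walk α s h P M) : Walk β s h P M := by
  obtain ⟨u, v, i, j, k, hij, hik, hjk⟩ := hs
  have h₁ : ∀ {i j k : Fin 3}, i ≠ k → j ≠ k → j = i + 1 → k = i + 2 ∧ i = k + 1 := by decide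
  have h₂ : ∀ {i j k : Fin 3}, i ≠ k → j ≠ k → j = i + 2 → k = i + 1 ∧ i = k + 2 := by decide
  have h₃ : ∀ {i j : Fin 3}, j = i + 1 → i ≠ j + 1 := by decide
  have h₄ : ∀ {i j : Fin 3}, j = i + 2 → i ≠ j + 2 := by decide
  simp only [List.append_assoc] at w ⊢
  induction u generalizing h P M with
  | nil =>
    simp only [List.nil_append, List.cons_append] at w ⊢
    cases w with
    | plus w e =>
      cases w with
      | plus w e' =>
        obtain rfl := w.head_eq
        exact (h₃ e' e).elim
      | minus w e' =>
        obtain rfl := w.head_eq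
        exact (w.plus (h₂ hik hjk e').1).minus (h₂ hik hjk e').2
    | minus w e =>
      cases w with
      | plus w e' =>
        obtain rfl := w.head_eq
        exact (w.minus (h₁ hik hjk e').1).plus (h₁ hik hjk e').2
      | minus w e' =>
        obtain rfl := w.head_eq
        exact (h₄ e' e).elim
  | cons t u ih =>
    rw [List.cons_append] at w ⊢
    generalize hγ : u ++ ([i, j, i] ++ v) = γ at w
    cases w with
    | single => simp at hγ
    | plus w e => exact (ih (hγ ▸ w)).plus e
    | minus w e => exact (ih (hγ ▸ w)).minus e

end Walk

theorem Step.symm {α β : List (Fin 3)} (h : Step α β) : Step β α := by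
  obtain ⟨u, v, i, j, k, hij, hik, hjk⟩ := h
  exact .mk u v i k j hik hij hjk.symm

theorem SameSeq.walk_iff {α β : List (Fin 3)} (hs : SameSeq α β) {s h : Fin 3} {P M : ℕ} :
    Walk α s h P M ↔ Walk β s h P M := by
  induction hs with
  | rel _ _ h => exact ⟨Walk.step h, Walk.step h.symm⟩
  | refl => rfl
  | symm _ _ _ ih => exact ih.symm
  | trans _ _ _ _ _ ih₁ ih₂ => exact ih₁.trans ih₂

theorem SameSeq.cons {α β : List (Fin 3)} (hs : SameSeq α β) (i : Fin 3) :
    SameSeq (i :: α) (i :: β) := by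
  induction hs with
  | rel _ _ h =>
    obtain ⟨u, v, a, b, c, h₁, h₂, h₃⟩ := h
    exact .rel _ _ (.mk (i :: u) v a b c h₁ h₂ h₃)
  | refl => exact .refl _
  | symm _ _ _ ih => exact ih.symm
  | trans _ _ _ _ _ ih₁ ih₂ => exact ih₁.trans _ _ _ ih₂

/-- The numbers of steps in both directions and the start determine a sequence up to
identification: sequences ending with different steps are joined through a sequence that ends with
both steps, in either order. -/
theorem Walk.sameSeq (N : ℕ) : ∀ {α β : List (Fin 3)} {s h h' : Fin 3} {P M : ℕ},
    P + M = N → Walk α s h P M → Walk β s h' P M → SameSeq α β := by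
  induction N with
  | zero =>
    intro α β s h h' P M hN w w'
    obtain ⟨rfl, rfl⟩ : P = 0 ∧ M = 0 := by lia
    cases w
    cases w'
    exact .refl _
  | succ N ih =>
    have swap : ∀ {α β : List (Fin 3)} {s h h' i i' : Fin 3} {P M : ℕ}, P + M + 1 = N →
        Walk α s h P (M + 1) → Walk β s h' (P + 1) M → i = h + 1 → i' = h' + 2 →
        SameSeq (i :: α) (i' :: β) := by
      intro α β s h h' i i' P M hN w w' hi hi'
      obtain ⟨γ, t, v⟩ := Walk.exists_walk s P M
      have v₁ := v.minus rfl
      have v₂ := v.plus rfl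
      have h₁ := ih (by lia) w v₁
      have h₂ := ih (by lia) w' v₂
      obtain rfl := w.head_unique v₁
      obtain rfl := w'.head_unique v₂
      obtain rfl : i = t := by
        rw [hi, add_assoc]
        exact add_zero t
      obtain rfl : i' = i := by
        rw [hi', add_assoc]
        exact add_zero i
      obtain ⟨δ, rfl⟩ := v.exists_eq_cons
      refine .trans _ _ _ (h₁.cons i') (.trans _ _ _ (.rel _ _ ?_) (h₂.cons i').symm)
      have hne : ∀ t : Fin 3, t ≠ t + 2 ∧ t ≠ t + 1 ∧ t + 2 ≠ t + 1 := by decide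
      exact Step.mk [] δ i' (i' + 2) (i' + 1) (hne i').1 (hne i').2.1 (hne i').2.2
    intro α β s h h' P M hN w w'
    cases w with
    | single => lia
    | plus w hi =>
      cases w' with
      | plus w' hi' =>
        obtain rfl := w.head_unique w'
        rw [hi, hi']
        exact (ih (by lia) w w').cons _
      | minus w' hi' => exact swap (by lia) w w' hi hi'
    | minus w hi =>
      cases w' with
      | plus w' hi' => exact (swap (by lia) w' w hi' hi).symm
      | minus w' hi' =>
        obtain rfl := w.head_unique w'
        rw [hi, hi']
        exact (ih (by lia) w w').cons _

theorem perm_add_one (σ : Equiv.Perm (Fin 3)) :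
    (∀ i, σ (i + 1) = σ i + 1) ∨ ∀ i, σ (i + 1) = σ i + 2 := by
  revert σ
  decide

theorem add_two_eq (i : Fin 3) : i + 2 = i + 1 + 1 := by
  revert i
  decide

theorem Walk.map_rotation {σ : Equiv.Perm (Fin 3)} (hσ : ∀ i, σ (i + 1) = σ i + 1)
    {α : List (Fin 3)} {s h : Fin 3} {P M : ℕ} (w : Walk α s h P M) :
    Walk (α.map σ) (σ s) (σ h) P M := by
  induction w with
  | single s => exact .single _
  | plus w hi ih => exact ih.plus (by rw [hi, hσ])
  | minus w hi ih => exact ih.minus (by rw [hi, add_two_eq, hσ, hσ, ← add_two_eq])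

theorem Walk.map_reflection {σ : Equiv.Perm (Fin 3)} (hσ : ∀ i, σ (i + 1) = σ i + 2)
    {α : List (Fin 3)} {s h : Fin 3} {P M : ℕ} (w : Walk α s h P M) :
    Walk (α.map σ) (σ s) (σ h) M P := by
  induction w with
  | single s => exact .single _
  | plus w hi ih => exact ih.minus (by rw [hi, hσ])
  | minus w hi ih =>
    refine ih.plus ?_
    rw [hi, add_two_eq, hσ, hσ, add_assoc]
    rfl

/-! ### The lines of the table -/

theorem walk_wpow_two_one (n : ℕ) : Walk (wpow [2, 1] (n + 1)) 1 2 (n + 1) n := by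
  induction n with
  | zero => exact (Walk.single 1).plus rfl
  | succ n ih => exact (ih.minus rfl).plus rfl

theorem Walk.wpow_append {α : List (Fin 3)} {s : Fin 3} {P M : ℕ} (w : Walk α s 2 P M) (n : ℕ) :
    Walk (wpow [2, 1, 3] n ++ α) s 2 (P + 3 * n) M := by
  induction n with
  | zero => exact w
  | succ n ih => exact ((ih.plus rfl).plus rfl).plus rfl

theorem walk_γ (k p : ℕ) :
    Walk (wpow [2, 1, 3] (2 * p) ++ wpow [2, 1] (2 * (k + 1))) 1 2
      (2 * (k + 1 + 3 * p)) (2 * k + 1) := by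
  have w := (walk_wpow_two_one (2 * k + 1)).wpow_append (2 * p)
  rwa [show 2 * k + 1 + 1 + 3 * (2 * p) = 2 * (k + 1 + 3 * p) by ring] at w

theorem walk_β (k p : ℕ) :
    Walk (wpow [2, 1, 3] (2 * p) ++ wpow [2, 1] (2 * k + 1)) 1 2
      (2 * (k + 3 * p) + 1) (2 * k) := by
  have w := (walk_wpow_two_one (2 * k)).wpow_append (2 * p)
  rwa [show 2 * k + 1 + 3 * (2 * p) = 2 * (k + 3 * p) + 1 by ring] at w

theorem walk_diag (n : ℕ) : Walk ([1] ++ wpow [2, 1] n) 1 1 n n := by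
  cases n with
  | zero => exact .single 1
  | succ n => exact (walk_wpow_two_one n).minus rfl

theorem oddOdd_g {p h n : Fin 3} (H : Triple p h n) (q m : ℕ) :
    (oddOdd p h n q m).g = (oddOdd p h n q m).e ⊓ (y p ⊓ y h ⊔ A n p q ⊓ a h n (m + 1)) := by
  have key : (oddOdd p h n q m).e = (oddOdd p h n q m).e ⊓ y h := by
    refine (inf_eq_left.2 ?_).symm
    simp only [oddOdd, inf_assoc]
    exact inf_le_left
  rw [key, inf_assoc, oddOdd_factor H, ← inf_assoc, ← key]
  rfl

theorem evenEven_g {p h n : Fin 3} (H : Triple p h n) (q m : ℕ) :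
    (evenEven p h n (q + 1) m).g =
      (evenEven p h n (q + 1) m).e ⊓ (y n ⊓ y h ⊔ A p h q ⊓ a n p (m + 1)) := by
  rw [evenEven_factor H]
  rfl

theorem evenEven_g_diag {p h n : Fin 3} (H : Triple p h n) (m : ℕ) :
    (evenEven p h n m m).g =
      (evenEven p h n m m).e ⊓ (y n ⊓ a n h m ⊔ y p ⊓ a p h m) := by
  simp only [evenEven]
  rw [inf_assoc _ (A p h m), inf_assoc _ (A p h m), evenEven_factor_diag H]

theorem oddOdd_g_diag {p h n : Fin 3} (H : Triple p h n) (m : ℕ) :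
    (oddOdd p h n m m).g =
      (oddOdd p h n m m).e ⊓ (y h ⊓ a h n (m + 1) ⊔ y h ⊓ a h p (m + 1)) := by
  have key : (oddOdd p h n m m).e = (oddOdd p h n m m).e ⊓ (y h ⊓ A n p m) := by
    refine (inf_eq_left.2 (le_inf ?_ ?_)).symm
    · simp only [oddOdd, inf_assoc]
      exact inf_le_left
    · refine le_trans ?_ (A_succ_le m n p)
      simp only [oddOdd, inf_assoc]
      exact inf_le_right.trans (inf_le_right.trans inf_le_left)
  rw [key, inf_assoc, oddOdd_factor_diag H, ← inf_assoc, ← key]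
  rfl

theorem triple_head (h : Fin 3) : Triple (h + 2) h (h + 1) := by
  refine ⟨?_, ?_, ?_⟩ <;> revert h <;> decide

/-- Every line of the table is an instance of the uniform notation. -/
theorem Table.exists_walk {w : List (Fin 3)} {f e g : D} (hT : Table w f e g) :
    ∃ h N M, M ≤ N ∧ Walk w 1 h N M ∧ (⟨f, e, g⟩ : Elements) = elements (h + 2) h (h + 1) N M := by
  cases hT with
  | line1 k p q γ e hk hq hγ he =>
    obtain ⟨k, rfl⟩ := Nat.exists_eq_succ_of_ne_zero hk.ne'
    subst hq hγ he
    refine ⟨2, 2 * (k + 1 + 3 * p), 2 * k + 1, by lia, walk_γ k p, ?_⟩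
    rw [elements_even_odd]
    rfl
  | line2 k p q γ e hk hq hγ he =>
    obtain ⟨k, rfl⟩ := Nat.exists_eq_succ_of_ne_zero hk.ne'
    subst hq hγ he
    refine ⟨3, 2 * (k + 1 + 3 * p) + 1, 2 * k + 1, by lia, (walk_γ k p).plus rfl, ?_⟩
    rw [elements_odd_odd]
    exact Elements.ext rfl rfl (oddOdd_g (triple_head 3) _ _).symm
  | line3 k p q γ e hk hq hγ he =>
    obtain ⟨k, rfl⟩ := Nat.exists_eq_succ_of_ne_zero hk.ne'
    subst hq hγ he
    refine ⟨1, 2 * ((k + 1 + 3 * p) + 1), 2 * k + 1, by lia, ((walk_γ k p).plus rfl).plus rfl, ?_⟩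
    rw [elements_even_odd]
    rfl
  | line4 k p q γ e hk hq hγ he =>
    obtain ⟨k, rfl⟩ := Nat.exists_eq_succ_of_ne_zero hk.ne'
    subst hq hγ he
    refine ⟨2, 2 * ((k + 1 + 3 * p) + 1) + 1, 2 * k + 1, by lia,
      (((walk_γ k p).plus rfl).plus rfl).plus rfl, ?_⟩
    rw [elements_odd_odd]
    exact Elements.ext rfl rfl (oddOdd_g (triple_head 2) _ _).symm
  | line5 k p q γ e hk hq hγ he =>
    obtain ⟨k, rfl⟩ := Nat.exists_eq_succ_of_ne_zero hk.ne'
    subst hq hγ he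
    refine ⟨3, 2 * ((k + 1 + 3 * p) + 2), 2 * k + 1, by lia,
      ((((walk_γ k p).plus rfl).plus rfl).plus rfl).plus rfl, ?_⟩
    rw [elements_even_odd]
    rfl
  | line6 k p q γ e hk hq hγ he =>
    obtain ⟨k, rfl⟩ := Nat.exists_eq_succ_of_ne_zero hk.ne'
    subst hq hγ he
    refine ⟨1, 2 * ((k + 1 + 3 * p) + 2) + 1, 2 * k + 1, by lia,
      (((((walk_γ k p).plus rfl).plus rfl).plus rfl).plus rfl).plus rfl, ?_⟩
    rw [elements_odd_odd, inf_comm (y 1) (y 3)]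
    exact Elements.ext rfl rfl (oddOdd_g (triple_head 1) _ _).symm
  | line7 k e he =>
    refine ⟨1, 2 * k, 2 * k, le_rfl, walk_diag _, ?_⟩
    rw [elements_even_even]
    have h : e = (evenEven 3 1 2 k k).e := by
      simp only [he, evenEven]
      ac_rfl
    rw [h]
    exact Elements.ext rfl rfl (evenEven_g_diag (triple_head 1) k).symm
  | line8 k e he =>
    refine ⟨1, 2 * k + 1, 2 * k + 1, le_rfl, walk_diag _, ?_⟩
    rw [elements_odd_odd]
    have h : e = (oddOdd 3 1 2 k k).e := by
      simp only [he, oddOdd]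
      ac_rfl
    rw [h]
    exact Elements.ext rfl rfl (oddOdd_g_diag (triple_head 1) k).symm
  | line9 k p q β e hq hβ he =>
    subst hq hβ he
    refine ⟨2, 2 * (k + 3 * p) + 1, 2 * k, by lia, walk_β k p, ?_⟩
    rw [elements_odd_even]
    rfl
  | line10 k p q β e hq hβ he =>
    subst hq hβ he
    refine ⟨3, 2 * ((k + 3 * p) + 1), 2 * k, by lia, (walk_β k p).plus rfl, ?_⟩
    rw [elements_even_even]
    exact Elements.ext rfl rfl (evenEven_g (triple_head 3) _ _).symm
  | line11 k p q β e hq hβ he =>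
    subst hq hβ he
    refine ⟨1, 2 * ((k + 3 * p) + 1) + 1, 2 * k, by lia, ((walk_β k p).plus rfl).plus rfl, ?_⟩
    rw [elements_odd_even]
    rfl
  | line12 k p q β e hq hβ he =>
    subst hq hβ he
    refine ⟨2, 2 * ((k + 3 * p) + 2), 2 * k, by lia,
      (((walk_β k p).plus rfl).plus rfl).plus rfl, ?_⟩
    rw [elements_even_even, inf_comm (y 2) (y 3)]
    exact Elements.ext rfl rfl (evenEven_g (triple_head 2) _ _).symm
  | line13 k p q β e hq hβ he =>
    subst hq hβ he
    refine ⟨3, 2 * ((k + 3 * p) + 2) + 1, 2 * k, by lia,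
      ((((walk_β k p).plus rfl).plus rfl).plus rfl).plus rfl, ?_⟩
    rw [elements_odd_even]
    rfl
  | line14 k p q β e hq hβ he =>
    subst hq hβ he
    refine ⟨1, 2 * ((k + 3 * p) + 3), 2 * k, by lia,
      (((((walk_β k p).plus rfl).plus rfl).plus rfl).plus rfl).plus rfl, ?_⟩
    rw [elements_even_even, inf_comm (y 1) (y 2)]
    exact Elements.ext rfl rfl (evenEven_g (triple_head 1) _ _).symm

/-- All pairs `M ≤ N` occur as the step numbers of a line of the table. -/
theorem exists_table {N M : ℕ} (h : M ≤ N) :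
    ∃ w f e g t, Table w f e g ∧ Walk w 1 t N M := by
  obtain ⟨D, rfl⟩ := Nat.exists_eq_add_of_le h
  cases D with
  | zero =>
    obtain ⟨k, rfl | rfl⟩ := Nat.even_or_odd' M
    · exact ⟨_, _, _, _, _, .line7 k _ rfl, walk_diag _⟩
    · exact ⟨_, _, _, _, _, .line8 k _ rfl, walk_diag _⟩
  | succ D =>
    -- For distinct step numbers the line is found from the parity of `M` and from `N - M - 1`
    -- modulo `6`.
    obtain ⟨p, r, hr, rfl⟩ : ∃ p r, r < 6 ∧ D = 6 * p + r :=
      ⟨D / 6, D % 6, Nat.mod_lt _ (by lia), (Nat.div_add_mod D 6).symm⟩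
    obtain ⟨k, rfl | rfl⟩ := Nat.even_or_odd' M
    · have w := walk_β k p
      rw [show 2 * k + (6 * p + r + 1) = 2 * (k + 3 * p) + 1 + r by ring]
      interval_cases r
      · exact ⟨_, _, _, _, _, .line9 k p _ _ _ rfl rfl rfl, w⟩
      · exact ⟨_, _, _, _, _, .line10 k p _ _ _ rfl rfl rfl, w.plus rfl⟩
      · exact ⟨_, _, _, _, _, .line11 k p _ _ _ rfl rfl rfl, (w.plus rfl).plus rfl⟩
      · exact ⟨_, _, _, _, _, .line12 k p _ _ _ rfl rfl rfl, ((w.plus rfl).plus rfl).plus rfl⟩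
      · exact ⟨_, _, _, _, _, .line13 k p _ _ _ rfl rfl rfl,
          (((w.plus rfl).plus rfl).plus rfl).plus rfl⟩
      · exact ⟨_, _, _, _, _, .line14 k p _ _ _ rfl rfl rfl,
          ((((w.plus rfl).plus rfl).plus rfl).plus rfl).plus rfl⟩
    · have w := walk_γ k p
      rw [show 2 * k + 1 + (6 * p + r + 1) = 2 * (k + 1 + 3 * p) + r by ring]
      interval_cases r
      · exact ⟨_, _, _, _, _, .line1 (k + 1) p _ _ _ k.succ_pos rfl rfl rfl, w⟩
      · exact ⟨_, _, _, _, _, .line2 (k + 1) p _ _ _ k.succ_pos rfl rfl rfl, w.plus rfl⟩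
      · exact ⟨_, _, _, _, _, .line3 (k + 1) p _ _ _ k.succ_pos rfl rfl rfl, (w.plus rfl).plus rfl⟩
      · exact ⟨_, _, _, _, _, .line4 (k + 1) p _ _ _ k.succ_pos rfl rfl rfl,
          ((w.plus rfl).plus rfl).plus rfl⟩
      · exact ⟨_, _, _, _, _, .line5 (k + 1) p _ _ _ k.succ_pos rfl rfl rfl,
          (((w.plus rfl).plus rfl).plus rfl).plus rfl⟩
      · exact ⟨_, _, _, _, _, .line6 (k + 1) p _ _ _ k.succ_pos rfl rfl rfl,
          ((((w.plus rfl).plus rfl).plus rfl).plus rfl).plus rfl⟩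

/-! ### Renaming the indices -/

theorem relabel_top (σ : Equiv.Perm (Fin 3)) : relabel σ ⊤ = ⊤ := lift_top _ _ _

theorem relabel_x (σ : Equiv.Perm (Fin 3)) (i : Fin 3) : relabel σ (x i) = x (σ i) :=
  lift_x _ _ _ i

theorem relabel_y (σ : Equiv.Perm (Fin 3)) (i : Fin 3) : relabel σ (y i) = y (σ i) :=
  lift_y _ _ _ i

theorem Triple.map {i j k : Fin 3} (H : Triple i j k) (σ : Equiv.Perm (Fin 3)) :
    Triple (σ i) (σ j) (σ k) :=
  ⟨σ.injective.ne H.ne₁₂, σ.injective.ne H.ne₂₃, σ.injective.ne H.ne₁₃⟩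

theorem relabel_a (σ : Equiv.Perm (Fin 3)) (n : ℕ) : ∀ {i j k : Fin 3}, Triple i j k →
    relabel σ (a i j n) = a (σ i) (σ j) n := by
  induction n with
  | zero => exact fun _ => relabel_top σ
  | succ n ih =>
    intro i j k H
    rw [H.a_succ, (H.map σ).a_succ, map_sup, map_inf, relabel_x, relabel_y, ih H.rot]

theorem relabel_A (σ : Equiv.Perm (Fin 3)) (n : ℕ) : ∀ {i j k : Fin 3}, Triple i j k →
    relabel σ (A i j n) = A (σ i) (σ j) n := by
  induction n with
  | zero => exact fun _ => relabel_top σ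
  | succ n ih =>
    intro i j k H
    rw [H.A_succ, (H.map σ).A_succ, map_sup, map_inf, relabel_x, relabel_y, ih H.rot.rot]

/-- The triple with the indices renamed by `σ`. -/
def Elements.relabel (σ : Equiv.Perm (Fin 3)) (E : Elements) : Elements where
  f := D222.relabel σ E.f
  e := D222.relabel σ E.e
  g := D222.relabel σ E.g

theorem relabel_elements (σ : Equiv.Perm (Fin 3)) {p h n : Fin 3} (H : Triple p h n) (N M : ℕ) :
    (elements p h n N M).relabel σ = elements (σ p) (σ h) (σ n) N M := by
  have a₁ := fun m => relabel_a σ m H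
  have a₂ := fun m => relabel_a σ m H.rot
  have a₃ := fun m => relabel_a σ m H.rot.rot
  have a₄ := fun m => relabel_a σ m H.swap
  have a₅ := fun m => relabel_a σ m H.swap.rot
  have a₆ := fun m => relabel_a σ m H.rot.swap
  have A₁ := fun m => relabel_A σ m H
  have A₂ := fun m => relabel_A σ m H.rot
  have A₃ := fun m => relabel_A σ m H.rot.rot
  have A₄ := fun m => relabel_A σ m H.swap
  have A₆ := fun m => relabel_A σ m H.rot.swap
  obtain ⟨q, rfl | rfl⟩ := Nat.even_or_odd' N <;> obtain ⟨m, rfl | rfl⟩ := Nat.even_or_odd' M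
  · rw [elements_even_even, elements_even_even]
    simp only [Elements.relabel, evenEven, map_inf, map_sup, relabel_x, relabel_y, *]
  · rw [elements_even_odd, elements_even_odd]
    simp only [Elements.relabel, evenOdd, map_inf, map_sup, relabel_x, relabel_y, *]
  · rw [elements_odd_even, elements_odd_even]
    simp only [Elements.relabel, oddEven, map_inf, map_sup, relabel_x, relabel_y, *]
  · rw [elements_odd_odd, elements_odd_odd]
    simp only [Elements.relabel, oddOdd, map_inf, map_sup, relabel_x, relabel_y, *]

/-! ### The elements of a given sequence -/

/-- The elements attached to a sequence depend only on its last index and its step numbers; the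
more frequent direction is the major one. -/
theorem AdmissibleElements.exists_walk {α : List (Fin 3)} {f e g : D}
    (hE : AdmissibleElements α f e g) : ∃ s h P M, Walk α s h P M ∧
      ((M ≤ P ∧ (⟨f, e, g⟩ : Elements) = elements (h + 2) h (h + 1) P M) ∨
        (P ≤ M ∧ (⟨f, e, g⟩ : Elements) = elements (h + 1) h (h + 2) M P)) := by
  obtain ⟨σ, w, f₀, e₀, g₀, hT, hs, rfl, rfl, rfl⟩ := hE
  obtain ⟨h, N, M, hNM, hw, hEq⟩ := hT.exists_walk
  have hr : (⟨relabel σ f₀, relabel σ e₀, relabel σ g₀⟩ : Elements) =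
      elements (σ (h + 2)) (σ h) (σ (h + 1)) N M := by
    rw [← relabel_elements σ (triple_head h), ← hEq]
    rfl
  rcases perm_add_one σ with hσ | hσ
  · refine ⟨_, _, _, _, hs.walk_iff.2 (hw.map_rotation hσ), .inl ⟨hNM, ?_⟩⟩
    rw [hr, add_two_eq h, hσ, hσ, ← add_two_eq]
  · refine ⟨_, _, _, _, hs.walk_iff.2 (hw.map_reflection hσ), .inr ⟨hNM, ?_⟩⟩
    rw [hr, add_two_eq h, hσ, hσ, add_assoc (σ h)]
    rfl

theorem exists_admissibleElements {α : List (Fin 3)} (hα : Admissible α) :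
    ∃ f e g, AdmissibleElements α f e g := by
  obtain ⟨s, h, P, M, hw⟩ := Walk.of_admissible hα
  rcases le_total M P with hMP | hMP
  · obtain ⟨w, f, e, g, t, hT, hw'⟩ := exists_table hMP
    -- The rotation that takes the start `1` of the table to `s`.
    have hσ : ∀ i, Equiv.addRight (s - 1) (i + 1) = Equiv.addRight (s - 1) i + 1 :=
      fun i => add_right_comm i 1 (s - 1)
    have v := hw'.map_rotation hσ
    rw [show Equiv.addRight (s - 1) 1 = s from add_sub_cancel 1 s] at v
    exact ⟨_, _, _, _, w, f, e, g, hT, Walk.sameSeq _ rfl hw v, rfl, rfl, rfl⟩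
  · obtain ⟨w, f, e, g, t, hT, hw'⟩ := exists_table hMP
    -- The reflection `t ↦ s + 1 - t` takes `1` to `s` and exchanges the two directions.
    have hσ : ∀ s i : Fin 3, Equiv.subLeft (s + 1) (i + 1) = Equiv.subLeft (s + 1) i + 2 := by
      decide
    have v := hw'.map_reflection (hσ s)
    rw [show Equiv.subLeft (s + 1) 1 = s from add_sub_cancel_right s 1] at v
    exact ⟨_, _, _, _, w, f, e, g, hT, Walk.sameSeq _ rfl hw v, rfl, rfl, rfl⟩

namespace Rep

variable {K : Type*} {X : Type u} [Field K] [AddCommGroup X] [Module K X]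

/-- The elements for a sequence that ends at `h` and has `P` steps `+1` and `M` steps `-1`. -/
def headElements (h : Fin 3) (P M : ℕ) : Elements :=
  if M ≤ P then elements (h + 2) h (h + 1) P M else elements (h + 1) h (h + 2) M P

theorem agree_headElements (ρ : Rep K X) {h : Fin 3} {P M : ℕ} {E : Elements}
    (hE : (M ≤ P ∧ E = elements (h + 2) h (h + 1) P M) ∨
      (P ≤ M ∧ E = elements (h + 1) h (h + 2) M P)) : Agree ρ E (headElements h P M) := by
  rcases hE with ⟨hMP, rfl⟩ | ⟨hPM, rfl⟩
  · rw [headElements, if_pos hMP]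
    exact .refl _
  · rcases hPM.eq_or_lt with rfl | hlt
    · rw [headElements, if_pos le_rfl]
      exact agree_elements_diag _ ρ (triple_head h).swap
    · rw [headElements, if_neg hlt.not_ge]
      exact .refl _

theorem carries_headElements_plus (ρ : Rep K X) {h i : Fin 3} (hi : i = h + 1) (P M : ℕ) :
    ρ.Carries i (headElements h P M) (headElements i (P + 1) M) := by
  have h₁ : h + 2 = i + 1 := by rw [hi, add_two_eq]
  have h₂ : h = i + 2 := by
    rw [hi, add_assoc]
    exact (add_zero h).symm
  rcases le_or_gt M P with hMP | hPM
  · have c := ρ.carries_major (triple_head h) P M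
    rw [h₁, ← hi] at c
    exact c.congr (agree_headElements _ (.inl ⟨hMP, by rw [h₁, ← hi]⟩)).symm
      (agree_headElements _ (.inl ⟨by lia, by rw [← h₂]⟩)).symm
  · have c := ρ.carries_minor (triple_head h).swap M P
    rw [h₁, ← hi] at c
    exact c.congr (agree_headElements _ (.inr ⟨hPM.le, by rw [h₁, ← hi]⟩)).symm
      (agree_headElements _ (.inr ⟨hPM, by rw [← h₂]⟩)).symm

theorem carries_headElements_minus (ρ : Rep K X) {h i : Fin 3} (hi : i = h + 2) (P M : ℕ) :
    ρ.Carries i (headElements h P M) (headElements i P (M + 1)) := by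
  have h₁ : h = i + 1 := by
    rw [hi, add_assoc]
    exact (add_zero h).symm
  have h₂ : h + 1 = i + 2 := by rw [h₁, add_two_eq]
  rcases lt_or_ge M P with hMP | hPM
  · have c := ρ.carries_minor (triple_head h) P M
    rw [h₂, ← hi] at c
    exact c.congr (agree_headElements _ (.inl ⟨hMP.le, by rw [h₂, ← hi]⟩)).symm
      (agree_headElements _ (.inl ⟨hMP, by rw [← h₁]⟩)).symm
  · have c := ρ.carries_major (triple_head h).swap M P
    rw [h₂, ← hi] at c
    exact c.congr (agree_headElements _ (.inr ⟨hPM, by rw [h₂, ← hi]⟩)).symm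
      (agree_headElements _ (.inr ⟨by lia, by rw [← h₁]⟩)).symm

/-- One more index on the left of a sequence corresponds to one elementary map. -/
theorem carries_of_admissibleElements (ρ : Rep K X) {α : List (Fin 3)} {i : Fin 3}
    {f e g f' e' g' : D} (hE : AdmissibleElements α f e g)
    (hE' : AdmissibleElements (i :: α) f' e' g') :
    ρ.Carries i ⟨f, e, g⟩ ⟨f', e', g'⟩ := by
  obtain ⟨s, h, P, M, w, hα⟩ := hE.exists_walk
  obtain ⟨s', h', P', M', w', hα'⟩ := hE'.exists_walk
  cases w' with
  | single => cases w
  | plus v hi =>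
    obtain ⟨rfl, rfl, rfl, rfl⟩ := w.unique v
    exact (carries_headElements_plus ρ hi P M).congr (agree_headElements _ hα)
      (agree_headElements _ hα')
  | minus v hi =>
    obtain ⟨rfl, rfl, rfl, rfl⟩ := w.unique v
    exact (carries_headElements_minus ρ hi P M).congr (agree_headElements _ hα)
      (agree_headElements _ hα')

end Rep

end D222

theorem mainTheorem1 {K X : Type*} [Field K] [AddCommGroup X] [Module K X]
    [FiniteDimensional K X] (α : List (Fin 3)) (hα : D222.Admissible α) (i : Fin 3)
    (hi : α.head? ≠ some i) :
    D222.Admissible (i :: α) ∧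
    (∃ f e g : D222.D, D222.AdmissibleElements α f e g) ∧
    (∃ f' e' g' : D222.D, D222.AdmissibleElements (i :: α) f' e' g') ∧
    ∀ f e g f' e' g' : D222.D, D222.AdmissibleElements α f e g →
      D222.AdmissibleElements (i :: α) f' e' g' →
      ∀ ρ : D222.Rep K X,
        (ρ.coxeter f).map (ρ.φ i) = ρ f' ∧
        (ρ.coxeter e).map (ρ.φ i) = ρ e' ∧
        (ρ.coxeter g).map (ρ.φ i) = ρ g' := by
  have hiα : D222.Admissible (i :: α) := by
    refine ⟨List.cons_ne_nil _ _, List.isChain_cons.2 ⟨?_, hα.2⟩⟩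
    rintro j hj rfl
    exact hi hj
  refine ⟨hiα, D222.exists_admissibleElements hα, D222.exists_admissibleElements hiα, ?_⟩
  intro f e g f' e' g' hE hE' ρ
  have c := ρ.carries_of_admissibleElements hE hE'
  exact ⟨c.f, c.e, c.g⟩
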